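/- Let $\mathbb R[q,r,q_x,r_x,q_{xx},r_{xx},\dots]$ be the ring of differential polynomials in two fields $q,r$, with total derivative $\partial_x$, and let $\partial_x^{-1}f$ denote the antiderivative of $f$ with zero constant term. The AKNS hierarchy is $\binom{q}{r}_{t_k}=K_k$, $k\ge1$, where $$K_1=\begin{pmatrix}-2q\\2r\end{pmatrix},\qquad K_{k+1}=\begin{pmatrix}-\frac12\partial_x b_k+q\,a_k\\ \frac12\partial_x c_k-r\,a_k\end{pmatrix},\qquad \begin{pmatrix}b_k\\c_k\end{pmatrix}=K_k,\qquad a_k=\partial_x^{-1}(r\,b_k+q\,c_k);$$ every $r\,b_k+q\,c_k$ is a total derivative, so that all $K_k$ are differential polynomials. For $n\ge 0$ let $$\mathbb U_{n+1}=\begin{pmatrix}\mathbb A&\mathbb B\\ \mathbb C&-\mathbb A\end{pmatrix},\quad \mathbb A=-\lambda^n+\tfrac12\sum_{i=2}^n a_i\lambda^{n-i},\quad \mathbb B=-\tfrac12\sum_{i=1}^n b_i\lambda^{n-i},\quad \mathbb C=\tfrac12\sum_{i=1}^n c_i\lambda^{n-i},$$ and let $h_k$ be the coefficient of $\lambda^k$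 in $\det\mathbb U_{n+1}$. Let $\mathcal M_n$ be the set of all jets (points of the space with coordinates $q,r,q_x,r_x,\dots$) that satisfy $K_{n+1}=0$ together with all its differential consequences $\partial_x^mK_{n+1}=0$. Then $q,r,q_x,r_x,\dots,q_{(n-1)x},r_{(n-1)x}$ are global coordinates on $\mathcal M_n$, which identify it with $\mathbb R^{2n}$ (all other jet coordinates being smooth functions of them on $\mathcal M_n$), and the flows $K_1,\dots,K_n$ are tangent to $\mathcal M_n$; their restriction to $\mathcal M_n$ is the $n$-th stationary AKNS system. On $\mathbb R^{2n}$ with coordinates $(\mathbf q,\mathbf p)=(q_1,\dots,q_n,p_1,\dots,p_n)$ set $q_0=1$, $q_m=0$ for $m<0$ or $m>n$, $G^{ij}=2q_{i+j-n-1}$ (always an invertible matrix), and $$H_k=\tfrac12\,\mathbf p^TA_kG\,\mathbf p+V_k^{(2n)},\qquad k=1,\dots,n,$$ where $(A_k)^i_j=q_{i-j+k-1}$ if $i\le j$ and $k\le j$, $(A_k)^i_j=-q_{i-j+k-1}$ if $i>j$ and $k>j$, and $(A_k)^i_j=0$ otherwise, and where $V^{(2n)}=R^{2n}(0,\dots,0,-1)^T$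 with $R$ the $n\times n$ matrix with first column $(-q_1,\dots,-q_n)^T$, ones on the superdiagonal and zeros elsewhere. These are the Hamiltonians of the Stäckel system of Benenti type with separation curve $\lambda^{2n}+\sum_{k=1}^nH_k\lambda^{n-k}=\mu^2$, written in Viète coordinates: for distinct real $\lambda_1,\dots,\lambda_n$ and arbitrary real $\mu_1,\dots,\mu_n$, at the point $$q_i=(-1)^is_i(\lambda_1,\dots,\lambda_n),\qquad p_i=-\sum_{k=1}^n\frac{\lambda_k^{n-i}\mu_k}{\prod_{j\ne k}(\lambda_k-\lambda_j)}$$ ($s_i$ the elementary symmetric polynomials) one has $\lambda_i^{2n}+\sum_{k=1}^nH_k\lambda_i^{n-k}=\mu_i^2$ for $i=1,\dots,n$, and this change of variables is canonical: $\sum_ip_i\,dq_i=\sum_i\mu_i\,d\lambda_i$. Theorem. For every $n$, the map from $\mathcal M_n$, with coordinates $q,r,\dots,q_{(n-1)x},r_{(n-1)x}$, to $\mathbb R^{2n}$, with coordinates $(\mathbf q,\mathbf p)$, given by $$q_i=-\tfrac12a_i-\tfrac14b_i-\tfrac14c_i,\qquad p_i=\tfrac12\sum_{j=1}^n(G^{-1})_{ij}(b_j-c_j),\qquad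 i=1,\dots,n$$ (with $G$ taken at the point $(q_1,\dots,q_n)$ given by the first formula), is a diffeomorphism. It transforms the $n$-th stationary AKNS system into the Stäckel system: for $k=1,\dots,n$ it carries the restriction of the flow $K_k$ to $\mathcal M_n$ onto the Hamiltonian flow $\dot q_i=\partial H_k/\partial p_i$, $\dot p_i=-\partial H_k/\partial q_i$. Moreover, under this map, $H_k=-h_{n-k}$ for $k=1,\dots,n$. -/

import Mathlib

open scoped ContDiff Matrix

noncomputable section

namespace AKNS

/-! ### Differential polynomials and the AKNS hierarchy -/

/-- Differential polynomials in the two fields `q, r`, with real coefficients: the variable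
`(0, m)` is the jet coordinate `q_{mx}`, the variable `(1, m)` is `r_{mx}`. -/
abbrev DiffPoly : Type := MvPolynomial (Fin 2 × ℕ) ℝ

/-- The infinite-dimensional jet space: a point assigns a value to every jet coordinate. -/
abbrev Jet : Type := Fin 2 × ℕ → ℝ

/-- The field `q` as a differential polynomial. -/
def q : DiffPoly := MvPolynomial.X (0, 0)

/-- The field `r` as a differential polynomial. -/
def r : DiffPoly := MvPolynomial.X (1, 0)

/-- The total derivative `∂_x`. -/
def D : Derivation ℝ DiffPoly DiffPoly :=
  MvPolynomial.mkDerivation ℝ fun s => MvPolynomial.X (s.1, s.2 + 1)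

open Classical in
/-- The operator `∂_x⁻¹`: the antiderivative without integration constant, that is the one that
vanishes when `q, r, q_x, r_x, …` all vanish (with value `0` if `f` is not a total derivative). -/
def integral (f : DiffPoly) : DiffPoly :=
  if h : ∃ g : DiffPoly, D g = f ∧ MvPolynomial.constantCoeff g = 0 then h.choose else 0

/-- The recursion operator
`(-∂/2 + q ∂⁻¹ r, q ∂⁻¹ q ; -r ∂⁻¹ r, ∂/2 - r ∂⁻¹ q)` applied to the column `(f.1, f.2)`. -/
def recursionOp (f : DiffPoly × DiffPoly) : DiffPoly × DiffPoly :=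
  (-MvPolynomial.C (1 / 2) * D f.1 + q * integral (r * f.1 + q * f.2),
    MvPolynomial.C (1 / 2) * D f.2 - r * integral (r * f.1 + q * f.2))

/-- The AKNS vector fields `K_k = 𝓡^{k-1} K_1`, `K_1 = (-2q, 2r)`, for `k ≥ 1`. -/
def K (k : ℕ) : DiffPoly × DiffPoly :=
  recursionOp^[k - 1] (-2 * q, 2 * r)

/-- `b_k`, the first component of `K_k` (`k ≥ 1`). -/
def b (k : ℕ) : DiffPoly := (K k).1

/-- `c_k`, the second component of `K_k` (`k ≥ 1`). -/
def c (k : ℕ) : DiffPoly := (K k).2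

/-- `a_k = ∂_x⁻¹ (r b_k + q c_k)` (`k ≥ 1`). -/
def a (k : ℕ) : DiffPoly := integral (r * b k + q * c k)

/-- The auxiliary Lax matrix `𝕌_m`, a polynomial in the spectral parameter, for `m ≥ 1`. -/
def U (m : ℕ) : Matrix (Fin 2) (Fin 2) (Polynomial DiffPoly) :=
  let half : Polynomial DiffPoly := Polynomial.C (MvPolynomial.C (1 / 2))
  let A := -Polynomial.X ^ (m - 1) +
    half * ∑ i ∈ Finset.Icc 2 (m - 1), Polynomial.C (a i) * Polynomial.X ^ (m - i - 1)
  let B := -half * ∑ i ∈ Finset.Icc 1 (m - 1), Polynomial.C (b i) * Polynomial.X ^ (m - i - 1)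
  let C := half * ∑ i ∈ Finset.Icc 1 (m - 1), Polynomial.C (c i) * Polynomial.X ^ (m - i - 1)
  !![A, B; C, -A]

/-- `h_k`: the coefficient at `λ^k` of `det 𝕌_{n+1}`. -/
def h (n k : ℕ) : DiffPoly := (U (n + 1)).det.coeff k

/-- The evolutionary vector field of `K_k` on the jet space: the component along the jet
coordinate `q_{mx}` (resp. `r_{mx}`) is `∂_x^m` of the first (resp. second) component of `K_k`. -/
def evolField (k : ℕ) (s : Fin 2 × ℕ) : DiffPoly :=
  D^[s.2] (if s.1 = 0 then b k else c k)

/-- The stationary manifold `M_n`: the jets that satisfy `K_{n+1} = 0` with all its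
differential consequences. -/
def stationary (n : ℕ) : Set Jet :=
  {z | ∀ s : Fin 2 × ℕ, MvPolynomial.eval z (evolField (n + 1) s) = 0}

/-- The values of the jet coordinates `q, r, …, q_{(n-1)x}, r_{(n-1)x}`. -/
abbrev LowJet (n : ℕ) : Type := Fin 2 × Fin n → ℝ

/-- The jet coordinates of order less than `n` of a jet. -/
def jetCoords (n : ℕ) (z : Jet) : LowJet n := fun s => z (s.1, s.2)

/-- The components of `K_k` at the jet `z` along the jet coordinates of order less than `n`. -/
def restrictedField (n k : ℕ) (z : Jet) : LowJet n :=
  fun s => MvPolynomial.eval z (evolField k (s.1, s.2))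

/-! ### The Stäckel system in Viète coordinates

Indices run over `Fin n`, so that `x i` is the coordinate with number `i + 1`. -/

/-- Phase space `T*ℝⁿ`: pairs of a position and a momentum. -/
abbrev Phase (n : ℕ) : Type := (Fin n → ℝ) × (Fin n → ℝ)

/-- `q_m` for an arbitrary integer `m`, with `q_0 = 1` and `q_m = 0` for `m < 0` or `m > n`. -/
def qExt {n : ℕ} (x : Fin n → ℝ) (m : ℤ) : ℝ :=
  if m = 0 then 1 else if hm : 1 ≤ m ∧ m ≤ n then x ⟨(m - 1).toNat, by omega⟩ else 0

/-- The contravariant metric `G^{ij} = 2 q_{i+j-n-1}`. -/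
def G {n : ℕ} (x : Fin n → ℝ) : Matrix (Fin n) (Fin n) ℝ :=
  Matrix.of fun i j => 2 * qExt x (((i : ℤ) + 1) + ((j : ℤ) + 1) - n - 1)

/-- The Killing tensors `A_k` (row `i`, column `j`). -/
def killing {n : ℕ} (k : Fin n) (x : Fin n → ℝ) : Matrix (Fin n) (Fin n) ℝ :=
  Matrix.of fun i j =>
    if i ≤ j ∧ k ≤ j then qExt x (((i : ℤ) + 1) - ((j : ℤ) + 1) + ((k : ℤ) + 1) - 1)
    else if j < i ∧ j < k then -qExt x (((i : ℤ) + 1) - ((j : ℤ) + 1) + ((k : ℤ) + 1) - 1)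
    else 0

/-- The recursion matrix of the basic separable potentials: first column `-q`, ones on the
superdiagonal. -/
def potentialMatrix {n : ℕ} (x : Fin n → ℝ) : Matrix (Fin n) (Fin n) ℝ :=
  Matrix.of fun i j =>
    (if (j : ℕ) = 0 then -x i else 0) + (if (j : ℕ) = i + 1 then 1 else 0)

/-- The basic separable potentials `V^{(α)} = R^α V^{(0)}`, `V^{(0)} = (0, …, 0, -1)`. -/
def potential {n : ℕ} (α : ℕ) (x : Fin n → ℝ) : Fin n → ℝ :=
  (potentialMatrix x ^ α) *ᵥ fun i => if (i : ℕ) + 1 = n then -1 else 0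

/-- The Stäckel Hamiltonians `H_k = ½ pᵀ A_k G p + V_k^{(2n)}`. -/
def hamiltonian {n : ℕ} (k : Fin n) (w : Phase n) : ℝ :=
  1 / 2 * (w.2 ⬝ᵥ ((killing k w.1 * G w.1) *ᵥ w.2)) + potential (2 * n) w.1 k

/-- The Hamiltonian vector field `(∂H/∂p, -∂H/∂q)` of `H` at `w = (q, p)`. -/
def hamField {n : ℕ} (H : Phase n → ℝ) (w : Phase n) : Phase n :=
  (fun i => fderiv ℝ H w (0, Pi.single i 1), fun i => -fderiv ℝ H w (Pi.single i 1, 0))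

/-- Viète coordinates `(q, p)` of the separation coordinates `(λ, μ)`:
`q_i = (-1)^i s_i(λ)` and `p_i = -∑_k λ_k^{n-i} μ_k / Δ_k`, `Δ_k = ∏_{j ≠ k} (λ_k - λ_j)`. -/
def viete {n : ℕ} (ξ : Phase n) : Phase n :=
  (fun i => (-1) ^ ((i : ℕ) + 1) *
      MvPolynomial.eval ξ.1 (MvPolynomial.esymm (Fin n) ℝ ((i : ℕ) + 1)),
    fun i => -∑ k, ξ.1 k ^ (n - ((i : ℕ) + 1)) * ξ.2 k /
      ∏ j ∈ Finset.univ.erase k, (ξ.1 k - ξ.1 j))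

/-! ### The change of variables -/

/-- The position part: `q_i = -a_i/2 - b_i/4 - c_i/4`. -/
def positions (n : ℕ) (z : Jet) : Fin n → ℝ := fun i =>
  -MvPolynomial.eval z (a (i + 1)) / 2 - MvPolynomial.eval z (b (i + 1)) / 4
    - MvPolynomial.eval z (c (i + 1)) / 4

/-- The momentum part: `p_i = ½ ∑_j (G⁻¹)_{ij} (b_j - c_j)`, with `G` taken at `positions n z`. -/
def momenta (n : ℕ) (z : Jet) : Fin n → ℝ := fun i =>
  1 / 2 * ∑ j : Fin n, (G (positions n z))⁻¹ i j *
    (MvPolynomial.eval z (b (j + 1)) - MvPolynomial.eval z (c (j + 1)))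

/-- The map from jets to Viète coordinates. -/
def toViete (n : ℕ) (z : Jet) : Phase n := (positions n z, momenta n z)

end AKNS

end

/-!
# Stationary AKNS systems are Stäckel systems

Collect the `a_k, b_k, c_k` in the power series `a = -2 + ∑ a_k zᵏ`, `b = ∑ b_k zᵏ`, `c = ∑ c_k zᵏ`
in `z = λ⁻¹`. The recursion is the stationary zero curvature equation for the matrix
`½ (a, -b; c, -a)`, so `∂_x (a² - b c) = 0`. Since only constants have vanishing total derivative
and everything vanishes at the zero jet, `a² - b c = 4` (`det_eq`). Compared coefficient by
coefficient, this shows that each `r b_k + q c_k` is a total derivative (`serA_eq`), and that `a_k`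
is a polynomial in the preceding `a_j, b_j, c_j` (`four_mul_a`). A derivation commuting with
`∂_x` that preserves the determinant and moves `q, r` along `K_k` acts on the matrix as the
commutator with its truncation: the difference of the two sides solves a triangular linear system
(`LaxSolution.flow`). This makes the flows commute (`evolD_evolField_comm`), and they are therefore
tangent to the stationary manifold. The latter is parametrized by the low order jet coordinates
because `K_{n+1}` has a leading term with constant coefficient (`lowerTerm_mem`, `jetPoly`).

On the stationary manifold `b_{n+1} = c_{n+1} = 0`, so the series truncated at order `n` solve the
same equations, and `LaxSolution.flow` applies again: multiplied by `λⁿ`, the truncations are the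
entries of a polynomial Lax matrix, on which each flow acts as a commutator (`lax_polynomial`).
A rotation by 45° brings this matrix into the form `(N, Q; T, -N)`, where `4 Q = -(2a + b + c)` and
`4 N = c - b`. Here `Q` is monic of degree `n`, its coefficients are the Viète positions, and `N`
has degree less than `n`. The determinant gives `N² + Q T = λ^{2n} + ∑ H_k λ^{n-k}`
(`diagPoly_sq`), where the `H_k` are for now the coefficients of degree less than `n`, and
`λ^{2n}` is the only other term because `a² - b c = 4` up to order `n` in `z`.

The Stäckel side is expressed through the functional `f ↦ Res (f / Q)` (`residue`). The
polynomials `λ^{n-i}` and the heads `A_k(λ) = λ^{k-1} + q_1 λ^{k-2} + ⋯ + q_{k-1}` of `Q` are dual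
bases for it (`residue_X_pow_mul_headPoly`). The momenta are the coefficients of
`μ(λ) = -∑ p_j A_j(λ)`, which takes the value `μ_i` at the root `λ_i` of `Q`. The metric, the
Killing tensors and the recursion matrix of the potentials become multiplication by `-2 μ`, by
`A_k` and by `λ` modulo `Q`; hence `H_k` is a coefficient of the remainder of `μ² - λ^{2n}` modulo
`Q` (`hamiltonian_eq`). This is the separation curve. In the same language the formula for the
momenta says `N = μ` (`momenta_jetMap`), so that the equation for the determinant gives
`H_k = -h_{n-k}`, and the Lax equation modulo `Q` is Hamilton's system (`hamilton_of_lax`).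

All the maps are polynomial. Solving for the jet coordinates one order at a time shows that
positions and momenta generate the ring of polynomials in the low order jet coordinates
(`pullback_surjective`). A surjection between polynomial rings in `2n` variables is an isomorphism
because these rings are Noetherian (`pullback_bijective`), so the inverse map is polynomial too.
-/

noncomputable section

namespace AKNS

/-! ### Coefficientwise derivations of power series -/


section Series

open PowerSeries

variable {R : Type*} [CommRing R]

/-- The part of a power series of degree at most `k`, again as a power series. -/
def lowPart (k : ℕ) (f : R⟦X⟧) : R⟦X⟧ :=
  PowerSeries.mk fun i => if i ≤ k then coeff i f else 0

@[simp] theorem coeff_lowPart (k i : ℕ) (f : R⟦X⟧) :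
    coeff i (lowPart k f) = if i ≤ k then coeff i f else 0 := by simp [lowPart]

variable [Algebra ℝ R]

/-- The extension of a derivation `δ` of `R` to `R⟦z⟧` that acts on coefficients. -/
def coeffD (δ : Derivation ℝ R R) (f : R⟦X⟧) : R⟦X⟧ := PowerSeries.mk fun i => δ (coeff i f)

@[simp] theorem coeff_coeffD (δ : Derivation ℝ R R) (f : R⟦X⟧) (i : ℕ) :
    coeff i (coeffD δ f) = δ (coeff i f) := by simp [coeffD]

theorem coeffD_add (δ : Derivation ℝ R R) (f g : R⟦X⟧) :
    coeffD δ (f + g) = coeffD δ f + coeffD δ g := by ext i; simp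

theorem coeffD_sub (δ : Derivation ℝ R R) (f g : R⟦X⟧) :
    coeffD δ (f - g) = coeffD δ f - coeffD δ g := by ext i; simp

theorem coeffD_mul (δ : Derivation ℝ R R) (f g : R⟦X⟧) :
    coeffD δ (f * g) = coeffD δ f * g + f * coeffD δ g := by
  ext i
  simp only [coeff_coeffD, map_add, coeff_mul, map_sum, Derivation.leibniz, smul_eq_mul,
    Finset.sum_add_distrib]
  rw [add_comm]
  congr 1
  exact Finset.sum_congr rfl fun _ _ => mul_comm _ _

theorem coeffD_X_pow_mul (δ : Derivation ℝ R R) (k : ℕ) (f : R⟦X⟧) :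
    coeffD δ (X ^ k * f) = X ^ k * coeffD δ f := by
  ext i
  simp only [coeff_coeffD, coeff_X_pow_mul']
  split_ifs <;> simp

theorem coeffD_X_mul (δ : Derivation ℝ R R) (f : R⟦X⟧) :
    coeffD δ (X * f) = X * coeffD δ f := by
  simpa using coeffD_X_pow_mul δ 1 f

theorem coeffD_C_mul (δ : Derivation ℝ R R) (t : R) (f : R⟦X⟧) :
    coeffD δ (C t * f) = C (δ t) * f + C t * coeffD δ f := by
  rw [coeffD_mul]
  congr 2
  ext i
  simp only [coeff_coeffD, coeff_C]
  split_ifs <;> simp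

theorem coeffD_two_mul (δ : Derivation ℝ R R) (f : R⟦X⟧) :
    coeffD δ (2 * f) = 2 * coeffD δ f := by
  rw [two_mul, coeffD_add, two_mul]

theorem coeffD_comm {δ D : Derivation ℝ R R} (h : ∀ f, δ (D f) = D (δ f)) (f : R⟦X⟧) :
    coeffD δ (coeffD D f) = coeffD D (coeffD δ f) := by
  ext i; simp [h]

/-! ### The stationary zero curvature equation and its symmetries -/

/-- The series `a, b, c` in `z = λ⁻¹` are the entries of a Lax matrix
`½ (a, -b; c, -a)` whose derivative along `D` is its commutator with the spatial Lax matrix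
of the fields `q, r`. -/
structure LaxSolution (D : Derivation ℝ R R) (q r : R) (a b c : R⟦X⟧) : Prop where
  eq_a : coeffD D a = C r * b + C q * c
  eq_b : X * coeffD D b = 2 * (X * (C q * a)) - 2 * b
  eq_c : X * coeffD D c = 2 * c + 2 * (X * (C r * a))
  zero_a : coeff 0 a = -2

variable {D δ : Derivation ℝ R R} {q r : R} {a b c : R⟦X⟧}

/-- The coefficients up to `m` of the linear system satisfied by the defect `(x, y, w)` of the
Lax equation vanish: the off-diagonal entries are determined by lower coefficients, and the
diagonal entry by the trace relation. -/
theorem coeff_eq_zero_of_linear [IsDomain R] [CharZero R] {x y w : R⟦X⟧} {M : ℕ}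
    (hb : X * coeffD D y = X * (C q * x) - 2 * y)
    (hc : X * coeffD D w = 2 * w + X * (C r * x))
    (ht : ∀ m < M, coeff m (a * x - b * w - c * y) = 0) (h0 : coeff 0 a = -2) :
    ∀ m < M, coeff m x = 0 ∧ coeff m y = 0 ∧ coeff m w = 0 := by
  have two : (2 : R) ≠ 0 := two_ne_zero
  intro m
  induction m using Nat.strong_induction_on with
  | _ m ih =>
    intro hm
    have hy : coeff m y = 0 := by
      have h := congrArg (coeff m) hb
      rcases m with _ | m
      · rw [← map_ofNat (C (R := R)) 2] at h
        simpa [two] using h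
      · have := ih m (by omega) (by omega)
        rw [← map_ofNat (C (R := R)) 2] at h
        simpa [coeff_succ_X_mul, this, two] using h
    have hw : coeff m w = 0 := by
      have h := congrArg (coeff m) hc
      rcases m with _ | m
      · rw [← map_ofNat (C (R := R)) 2] at h
        simpa [two] using h
      · have := ih m (by omega) (by omega)
        rw [← map_ofNat (C (R := R)) 2] at h
        simpa [coeff_succ_X_mul, this, two] using h
    refine ⟨?_, hy, hw⟩
    have e1 : coeff m (b * w) = 0 := by
      rw [coeff_mul]
      refine Finset.sum_eq_zero fun p hp => ?_
      have hp2 : p.2 ≤ m := by have := Finset.HasAntidiagonal.mem_antidiagonal.1 hp; omega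
      rcases hp2.lt_or_eq with h | h
      · rw [(ih _ h (by omega)).2.2, mul_zero]
      · rw [h, hw, mul_zero]
    have e2 : coeff m (c * y) = 0 := by
      rw [coeff_mul]
      refine Finset.sum_eq_zero fun p hp => ?_
      have hp2 : p.2 ≤ m := by have := Finset.HasAntidiagonal.mem_antidiagonal.1 hp; omega
      rcases hp2.lt_or_eq with h | h
      · rw [(ih _ h (by omega)).2.1, mul_zero]
      · rw [h, hy, mul_zero]
    have e3 : coeff m (a * x) = -2 * coeff m x := by
      rw [coeff_mul, Finset.sum_eq_single (0, m), h0]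
      · intro p hp hne
        have h1 := Finset.HasAntidiagonal.mem_antidiagonal.1 hp
        have : p.1 ≠ 0 := fun h => hne (Prod.ext h (by dsimp; omega))
        rw [(ih p.2 (by omega) (by omega)).1, mul_zero]
      · simp
    have h := ht m hm
    rw [map_sub, map_sub, e1, e2, e3] at h
    simpa [two] using h

/-- The truncations of a Lax solution satisfy the zero curvature equation up to one coefficient
in the off-diagonal entries. -/
theorem LaxSolution.lowPart_eqs (h : LaxSolution D q r a b c) (k : ℕ) :
    coeffD D (lowPart k a) = C r * lowPart k b + C q * lowPart k c ∧
    X * coeffD D (lowPart k b) = 2 * (X * (C q * lowPart k a)) - 2 * lowPart k b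
      - 2 * (X ^ (k + 1) * C (coeff (k + 1) b)) ∧
    X * coeffD D (lowPart k c) = 2 * lowPart k c + 2 * (X * (C r * lowPart k a))
      + 2 * (X ^ (k + 1) * C (coeff (k + 1) c)) := by
  refine ⟨?_, ?_, ?_⟩
  · ext i
    have := congrArg (coeff i) h.eq_a
    simp only [map_add, coeff_coeffD, coeff_C_mul] at this
    by_cases hi : i ≤ k <;> simp [hi, this]
  · ext i
    have h2 := congrArg (coeff i) h.eq_b
    rw [← map_ofNat (C (R := R)) 2] at h2 ⊢
    rcases i with _ | i
    · have e : ∀ f : R⟦X⟧, constantCoeff (lowPart k f) = constantCoeff f := fun f => by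
        simp [← coeff_zero_eq_constantCoeff_apply, -coeff_zero_eq_constantCoeff]
      simpa [coeff_X_pow_mul', e] using h2
    · simp only [map_sub, coeff_C_mul, coeff_succ_X_mul, coeff_coeffD] at h2
      simp only [map_sub, coeff_C_mul, coeff_succ_X_mul, coeff_coeffD, coeff_lowPart,
        coeff_X_pow_mul', coeff_C]
      rcases lt_trichotomy i k with hi | hi | hi
      · simp [hi.le, Nat.succ_le_of_lt hi, h2, show ¬ (k ≤ i) by omega]
      · subst hi; simp [h2]
      · simp [show ¬ (i ≤ k) by omega, show ¬ (i + 1 ≤ k) by omega, hi.le, show i - k ≠ 0 by omega]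
  · ext i
    have h2 := congrArg (coeff i) h.eq_c
    rw [← map_ofNat (C (R := R)) 2] at h2 ⊢
    rcases i with _ | i
    · have e : ∀ f : R⟦X⟧, constantCoeff (lowPart k f) = constantCoeff f := fun f => by
        simp [← coeff_zero_eq_constantCoeff_apply, -coeff_zero_eq_constantCoeff]
      simpa [coeff_X_pow_mul', e] using h2
    · simp only [map_add, coeff_C_mul, coeff_succ_X_mul, coeff_coeffD] at h2
      simp only [map_add, coeff_C_mul, coeff_succ_X_mul, coeff_coeffD, coeff_lowPart,
        coeff_X_pow_mul', coeff_C]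
      rcases lt_trichotomy i k with hi | hi | hi
      · simp [hi.le, Nat.succ_le_of_lt hi, h2, show ¬ (k ≤ i) by omega]
      · subst hi; simp [h2, add_comm]
      · simp [show ¬ (i ≤ k) by omega, show ¬ (i + 1 ≤ k) by omega, hi.le, show i - k ≠ 0 by omega]

/-- The determinant of a Lax solution is constant along `D`. -/
theorem LaxSolution.det_const [IsDomain R] (h : LaxSolution D q r a b c) :
    coeffD D (a * a - b * c) = 0 := by
  have hX : (X : R⟦X⟧) ≠ 0 := X_ne_zero
  -- the equations give the derivatives of `b` and `c` after multiplication by the variable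
  apply mul_left_cancel₀ hX
  rw [coeffD_sub, coeffD_mul, coeffD_mul]
  linear_combination 2 * X * a * h.eq_a - c * h.eq_b - b * h.eq_c

/-- A derivation `δ` that commutes with `D`, moves the fields by the coefficient `k + 1` of the
off-diagonal entries and preserves the determinant up to order `N` acts on the Lax matrix by
the commutator with its truncation. The difference of the two sides solves the linear system
of `coeff_eq_zero_of_linear`. -/
theorem LaxSolution.flow [IsDomain R] [CharZero R] (h : LaxSolution D q r a b c) {k N : ℕ}
    (comm : ∀ f, δ (D f) = D (δ f)) (hq : δ q = coeff (k + 1) b) (hr : δ r = coeff (k + 1) c)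
    (hdet : ∀ m ≤ N, δ (coeff m (a * a - b * c)) = 0) :
    ∀ m ≤ N + k,
      coeff m (2 * (X ^ k * coeffD δ a)) = coeff m (b * lowPart k c - lowPart k b * c) ∧
      coeff m (X ^ k * coeffD δ b) = coeff m (lowPart k a * b - a * lowPart k b) ∧
      coeff m (X ^ k * coeffD δ c) = coeff m (lowPart k c * a - c * lowPart k a) := by
  obtain ⟨va, vb, vc⟩ := h.lowPart_eqs k
  have ha := congrArg (coeffD δ) h.eq_a
  have hb := congrArg (coeffD δ) h.eq_b
  have hc := congrArg (coeffD δ) h.eq_c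
  rw [coeffD_add, coeffD_C_mul, coeffD_C_mul, coeffD_comm comm, hq, hr] at ha
  rw [coeffD_sub, coeffD_two_mul, coeffD_two_mul, coeffD_X_mul, coeffD_X_mul, coeffD_C_mul,
    coeffD_comm comm, hq] at hb
  rw [coeffD_add, coeffD_two_mul, coeffD_two_mul, coeffD_X_mul, coeffD_X_mul, coeffD_C_mul,
    coeffD_comm comm, hr] at hc
  have key := coeff_eq_zero_of_linear (D := D) (q := q) (r := r) (a := a) (b := b) (c := c)
    (x := 2 * (X ^ k * coeffD δ a) - (b * lowPart k c - lowPart k b * c))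
    (y := X ^ k * coeffD δ b - (lowPart k a * b - a * lowPart k b))
    (w := X ^ k * coeffD δ c - (lowPart k c * a - c * lowPart k a)) (M := N + k + 1)
    ?_ ?_ ?_ h.zero_a
  · intro m hm
    obtain ⟨h1, h2, h3⟩ := key m (by omega)
    rw [map_sub, sub_eq_zero] at h1 h2 h3
    exact ⟨h1, h2, h3⟩
  · rw [coeffD_sub, coeffD_X_pow_mul, coeffD_sub, coeffD_mul, coeffD_mul]
    linear_combination X ^ k * hb - b * X * va - lowPart k a * h.eq_b + a * vb
      + lowPart k b * X * h.eq_a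
  · rw [coeffD_sub, coeffD_X_pow_mul, coeffD_sub, coeffD_mul, coeffD_mul]
    linear_combination X ^ k * hc - a * vc - lowPart k c * X * h.eq_a + c * X * va
      + lowPart k a * h.eq_c
  · -- the trace of the Lax matrix times the defect is the derivative of the determinant
    intro m hm
    have e : a * (2 * (X ^ k * coeffD δ a) - (b * lowPart k c - lowPart k b * c))
        - b * (X ^ k * coeffD δ c - (lowPart k c * a - c * lowPart k a))
        - c * (X ^ k * coeffD δ b - (lowPart k a * b - a * lowPart k b))
        = X ^ k * coeffD δ (a * a - b * c) := by
      rw [coeffD_sub, coeffD_mul, coeffD_mul]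
      ring
    rw [e, coeff_X_pow_mul']
    split_ifs with hk
    · rw [coeff_coeffD, hdet _ (by omega)]
    · rfl

end Series

/-! ### Constants of the total derivative -/

open MvPolynomial in
/-- The commutator of `∂/∂u_{(m+1)x}` and `∂_x` is `∂/∂u_{mx}`. -/
theorem pderiv_D_succ (i : Fin 2) (m : ℕ) (f : DiffPoly) :
    pderiv (i, m + 1) (D f) = D (pderiv (i, m + 1) f) + pderiv (i, m) f := by
  have h : (⁅pderiv (R := ℝ) (i, m + 1), D⁆ : Derivation ℝ DiffPoly DiffPoly) = pderiv (i, m) := by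
    classical
    refine MvPolynomial.derivation_ext fun s => ?_
    rw [Derivation.commutator_apply]
    simp only [D, mkDerivation_X, pderiv_X, Pi.single_apply]
    obtain ⟨j, l⟩ := s
    by_cases hj : j = i <;> by_cases hl : l = m <;> simp [hj, hl]
    all_goals split_ifs <;> simp
  have := congrArg (fun d => d f) h
  rw [Derivation.commutator_apply] at this
  rw [← this]; ring

open MvPolynomial in
/-- Only constants have vanishing total derivative: by `pderiv_D_succ`, if `∂f/∂u_{(m+1)x} = 0`
then `∂f/∂u_{mx} = 0`, and `f` has finite order. -/
theorem eq_C_of_D_eq_zero {f : DiffPoly} (hf : D f = 0) : f = C (constantCoeff f) := by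
  have step : ∀ i m, pderiv (i, m + 1) f = 0 → pderiv (i, m) f = 0 := by
    intro i m h
    have := pderiv_D_succ i m f
    rw [hf, h] at this
    simpa using this.symm
  have desc : ∀ i m l, pderiv (i, m + l) f = 0 → pderiv (i, m) f = 0 := by
    intro i m l
    induction l with
    | zero => exact id
    | succ l ih => exact fun h => ih (step i (m + l) h)
  obtain ⟨M, hM⟩ : ∃ M, ∀ s ∈ f.vars, s.2 < M :=
    ⟨f.vars.sup Prod.snd + 1, fun s hs => Nat.lt_succ_of_le (Finset.le_sup (f := Prod.snd) hs)⟩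
  have all : ∀ s, pderiv s f = 0 := by
    rintro ⟨i, m⟩
    refine desc i m M (pderiv_eq_zero_of_notMem_vars fun h => ?_)
    have := hM _ h
    dsimp at this
    omega
  ext d
  rw [coeff_C]
  split_ifs with hd
  · rw [← hd]; rfl
  · obtain ⟨s, hs⟩ : ∃ s, d s ≠ 0 := by
      by_contra! h
      exact hd (Finsupp.ext fun s => (h s).symm)
    have h := congrArg (coeff (d - Finsupp.single s 1)) (all s)
    rw [coeff_pderiv, coeff_zero, tsub_add_cancel_of_le
      (by rw [Finsupp.single_le_iff]; omega)] at h
    rcases mul_eq_zero.1 h with h | h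
    · exact h
    · exact absurd h (by positivity)

/-! ### Locality of the hierarchy -/

section Hierarchy

open MvPolynomial

theorem constantCoeff_D (f : DiffPoly) : constantCoeff (D f) = 0 := by
  induction f using MvPolynomial.induction_on with
  | C t => simp [derivation_C]
  | add f g hf hg => simp [hf, hg]
  | mul_X f s hf => simp [D, mkDerivation_X, Derivation.leibniz] at hf ⊢

theorem derivation_const_mul {σ : Type*}
    (δ : Derivation ℝ (MvPolynomial σ ℝ) (MvPolynomial σ ℝ)) (t : ℝ) (f : MvPolynomial σ ℝ) :
    δ (C t * f) = C t * δ f := by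
  rw [C_mul', δ.map_smul, C_mul']

theorem D_sub_C (f : DiffPoly) (t : ℝ) : D (f - C t) = D f := by
  simp [derivation_C]

theorem constantCoeff_integral (f : DiffPoly) : constantCoeff (integral f) = 0 := by
  unfold integral
  split_ifs with h
  · exact h.choose_spec.2
  · simp

theorem D_integral {f g : DiffPoly} (h : D g = f) : D (integral f) = f := by
  have h' : ∃ g : DiffPoly, D g = f ∧ constantCoeff g = 0 :=
    ⟨g - C (constantCoeff g), by rw [D_sub_C, h], by simp⟩
  rw [integral, dif_pos h']
  exact h'.choose_spec.1

theorem b_one : b 1 = -2 * q := rfl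

theorem c_one : c 1 = 2 * r := rfl

theorem K_succ {k : ℕ} (hk : 1 ≤ k) : K (k + 1) = recursionOp (K k) := by
  obtain ⟨k, rfl⟩ := Nat.exists_eq_add_of_le' hk
  exact Function.iterate_succ_apply' _ _ _

theorem b_succ {k : ℕ} (hk : 1 ≤ k) : b (k + 1) = -C (1 / 2) * D (b k) + q * a k := by
  rw [b, K_succ hk]; rfl

theorem c_succ {k : ℕ} (hk : 1 ≤ k) : c (k + 1) = C (1 / 2) * D (c k) - r * a k := by
  rw [c, K_succ hk]; rfl

theorem constantCoeff_b (k : ℕ) : constantCoeff (b (k + 1)) = 0 := by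
  rcases k with _ | k
  · simp [b_one, q]
  · simp [b_succ, constantCoeff_D, q]

theorem constantCoeff_a (k : ℕ) : constantCoeff (a k) = 0 := constantCoeff_integral _

/-- The sequence `a_1, a_2, …`. -/
def tailA : PowerSeries DiffPoly := PowerSeries.mk fun i => a (i + 1)

/-- The sequence `b_1, b_2, …`. -/
def tailB : PowerSeries DiffPoly := PowerSeries.mk fun i => b (i + 1)

/-- The sequence `c_1, c_2, …`. -/
def tailC : PowerSeries DiffPoly := PowerSeries.mk fun i => c (i + 1)

/-- The generating series `∑ a_i zⁱ`, with `a_0 = -2`. -/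
def serA : PowerSeries DiffPoly := -2 + PowerSeries.X * tailA

/-- The generating series `∑ b_i zⁱ`, with `b_0 = 0`. -/
def serB : PowerSeries DiffPoly := PowerSeries.X * tailB

/-- The generating series `∑ c_i zⁱ`, with `c_0 = 0`. -/
def serC : PowerSeries DiffPoly := PowerSeries.X * tailC

theorem coeff_neg_two (i : ℕ) :
    PowerSeries.coeff i (-2 : PowerSeries DiffPoly) = if i = 0 then -2 else 0 := by
  rw [← map_ofNat (PowerSeries.C (R := DiffPoly)) 2, ← map_neg, PowerSeries.coeff_C]

@[simp] theorem coeff_zero_serA : PowerSeries.coeff 0 serA = -2 := by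
  simp only [serA, map_add, coeff_neg_two, PowerSeries.coeff_zero_X_mul]; simp

@[simp] theorem coeff_succ_serA (i : ℕ) : PowerSeries.coeff (i + 1) serA = a (i + 1) := by
  simp only [serA, map_add, coeff_neg_two, PowerSeries.coeff_succ_X_mul]; simp [tailA]

@[simp] theorem coeff_zero_serB : PowerSeries.coeff 0 serB = 0 := by
  simp only [serB, PowerSeries.coeff_zero_X_mul]

@[simp] theorem coeff_succ_serB (i : ℕ) : PowerSeries.coeff (i + 1) serB = b (i + 1) := by
  simp only [serB, PowerSeries.coeff_succ_X_mul]; simp [tailB]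

@[simp] theorem coeff_zero_serC : PowerSeries.coeff 0 serC = 0 := by
  simp only [serC, PowerSeries.coeff_zero_X_mul]

@[simp] theorem coeff_succ_serC (i : ℕ) : PowerSeries.coeff (i + 1) serC = c (i + 1) := by
  simp only [serC, PowerSeries.coeff_succ_X_mul]; simp [tailC]

theorem two_mul_C_half : (2 : DiffPoly) * C (1 / 2) = 1 := by
  rw [← map_ofNat (C (σ := Fin 2 × ℕ) (R := ℝ)) 2, ← C_mul]; norm_num

theorem serB_eq : PowerSeries.X * coeffD D serB =
    2 * (PowerSeries.X * (PowerSeries.C q * serA)) - 2 * serB := by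
  ext1 i
  rw [← map_ofNat (PowerSeries.C (R := DiffPoly)) 2]
  rcases i with _ | _ | i
  · simp only [map_sub, PowerSeries.coeff_C_mul, PowerSeries.coeff_zero_X_mul, coeff_zero_serB]
    ring
  · simp only [map_sub, PowerSeries.coeff_C_mul, PowerSeries.coeff_succ_X_mul, coeff_coeffD,
      coeff_zero_serB, coeff_zero_serA, coeff_succ_serB, b_one, map_zero, zero_add]
    ring
  · simp only [map_sub, PowerSeries.coeff_C_mul, PowerSeries.coeff_succ_X_mul, coeff_coeffD,
      coeff_succ_serB, coeff_succ_serA, b_succ (Nat.le_add_left 1 i)]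
    linear_combination -D (b (i + 1)) * two_mul_C_half

theorem serC_eq : PowerSeries.X * coeffD D serC =
    2 * serC + 2 * (PowerSeries.X * (PowerSeries.C r * serA)) := by
  ext1 i
  rw [← map_ofNat (PowerSeries.C (R := DiffPoly)) 2]
  rcases i with _ | _ | i
  · simp only [map_add, PowerSeries.coeff_C_mul, PowerSeries.coeff_zero_X_mul, coeff_zero_serC]
    ring
  · simp only [map_add, PowerSeries.coeff_C_mul, PowerSeries.coeff_succ_X_mul, coeff_coeffD,
      coeff_zero_serC, coeff_zero_serA, coeff_succ_serC, c_one, map_zero, zero_add]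
    ring
  · simp only [map_add, PowerSeries.coeff_C_mul, PowerSeries.coeff_succ_X_mul, coeff_coeffD,
      coeff_succ_serC, coeff_succ_serA, c_succ (Nat.le_add_left 1 i)]
    linear_combination -D (c (i + 1)) * two_mul_C_half

/-- The equations for `b` and `c` alone imply this, before `∂_x a_k = r b_k + q c_k` is known. -/
theorem coeffD_det : coeffD D (serA * serA - serB * serC) =
    PowerSeries.C 2 *
      (serA * (coeffD D serA - (PowerSeries.C r * serB + PowerSeries.C q * serC))) := by
  have hX : (PowerSeries.X : PowerSeries DiffPoly) ≠ 0 := PowerSeries.X_ne_zero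
  apply mul_left_cancel₀ hX
  rw [coeffD_sub, coeffD_mul, coeffD_mul, map_ofNat]
  linear_combination -serC * serB_eq - serB * serC_eq

/-- Each `r b_k + q c_k` is a total derivative: if this holds up to `k - 1`, then the derivative
of the coefficient of `z^k` in `a² - b c` equals `-4 (∂_x a_k - (r b_k + q c_k))`. -/
theorem serA_eq : coeffD D serA = PowerSeries.C r * serB + PowerSeries.C q * serC := by
  rw [← sub_eq_zero]
  ext1 k
  rw [map_zero]
  induction k using Nat.strong_induction_on with
  | _ k ih =>
    rcases k with _ | k
    · have h2 : D (-2 : DiffPoly) = 0 := by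
        rw [← map_ofNat (C (σ := Fin 2 × ℕ) (R := ℝ)) 2, ← map_neg, derivation_C]
      simp only [map_sub, map_add, PowerSeries.coeff_C_mul, coeff_coeffD, coeff_zero_serA,
        coeff_zero_serB, coeff_zero_serC, h2]
      simp
    · have h := congrArg (PowerSeries.coeff (k + 1)) coeffD_det
      rw [coeff_coeffD, PowerSeries.coeff_C_mul, PowerSeries.coeff_mul _ serA,
        Finset.sum_eq_single (0, k + 1)] at h
      · simp only [map_sub, map_add, PowerSeries.coeff_C_mul, coeff_coeffD, coeff_zero_serA,
          coeff_succ_serA, coeff_succ_serB, coeff_succ_serC] at h ⊢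
        rw [sub_eq_zero]
        -- the derivative of this `g` is the integrand, by `coeffD_det` and the induction hypothesis
        refine D_integral (g := C (1 / 4) * (PowerSeries.coeff (k + 1) (serA * serA)
          - PowerSeries.coeff (k + 1) (serB * serC)) + a (k + 1)) ?_
        have h4 : (4 : DiffPoly) * C (1 / 4) = 1 := by
          rw [← map_ofNat (C (σ := Fin 2 × ℕ) (R := ℝ)) 4, ← C_mul]; norm_num
        rw [map_add, derivation_const_mul, map_sub, h]
        linear_combination -(D (a (k + 1)) - (r * b (k + 1) + q * c (k + 1))) * h4
      · intro p hp hne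
        have h1 := Finset.HasAntidiagonal.mem_antidiagonal.1 hp
        have : p.1 ≠ 0 := fun h => hne (Prod.ext h (by dsimp; omega))
        rw [ih p.2 (by omega), mul_zero]
      · simp

theorem laxSolution : LaxSolution D q r serA serB serC :=
  ⟨serA_eq, serB_eq, serC_eq, coeff_zero_serA⟩

theorem D_a {k : ℕ} (hk : 1 ≤ k) : D (a k) = r * b k + q * c k := by
  obtain ⟨k, rfl⟩ := Nat.exists_eq_add_of_le' hk
  have h := congrArg (PowerSeries.coeff (k + 1)) serA_eq
  simpa using h

/-- The determinant of the generating series is its value at the zero jet. -/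
theorem det_eq : serA * serA - serB * serC = PowerSeries.C 4 := by
  ext1 k
  have h := congrArg (PowerSeries.coeff k) laxSolution.det_const
  rw [coeff_coeffD, map_zero] at h
  rw [eq_C_of_D_eq_zero h]
  -- evaluation at the zero jet leaves only the constant term `-2` of `a`
  have hA : PowerSeries.map constantCoeff tailA = 0 := by
    ext i; simp [tailA, constantCoeff_a]
  have hB : PowerSeries.map constantCoeff tailB = 0 := by
    ext i; simp [tailB, constantCoeff_b]
  have h1 : PowerSeries.map constantCoeff (serA * serA - serB * serC) = PowerSeries.C 4 := by
    rw [serA, serB, map_sub, map_mul, map_add, map_mul, map_mul, map_mul, hA, hB, map_neg,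
      map_ofNat, map_ofNat]
    ring
  rw [← PowerSeries.coeff_map, h1, PowerSeries.coeff_C, PowerSeries.coeff_C]
  split_ifs
  · exact map_ofNat C 4
  · simp

/-- The relation `a² - b c = 4`, solved for the linear term in the tail of `a`. -/
theorem four_mul_tailA : PowerSeries.C 4 * tailA =
    PowerSeries.X * (tailA * tailA - tailB * tailC) := by
  have hX : (PowerSeries.X : PowerSeries DiffPoly) ≠ 0 := PowerSeries.X_ne_zero
  apply mul_left_cancel₀ hX
  have := det_eq
  rw [serA, serB, serC, map_ofNat] at this
  rw [map_ofNat]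
  linear_combination -this

/-- The relation `4 a_{k+2} = ∑ (a_i a_j - b_i c_j)`, the sum over positive `i + j = k + 2`. -/
theorem four_mul_a (k : ℕ) : 4 * a (k + 2) = ∑ p ∈ Finset.HasAntidiagonal.antidiagonal k,
    (a (p.1 + 1) * a (p.2 + 1) - b (p.1 + 1) * c (p.2 + 1)) := by
  have h := congrArg (PowerSeries.coeff (k + 1)) four_mul_tailA
  rw [PowerSeries.coeff_C_mul, PowerSeries.coeff_succ_X_mul, map_sub, PowerSeries.coeff_mul,
    PowerSeries.coeff_mul, ← Finset.sum_sub_distrib] at h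
  simpa only [tailA, tailB, tailC, PowerSeries.coeff_mk] using h

theorem a_one : a 1 = 0 := by
  have h := congrArg (PowerSeries.coeff 0) four_mul_tailA
  simp only [PowerSeries.coeff_C_mul, PowerSeries.coeff_zero_X_mul, tailA,
    PowerSeries.coeff_mk] at h
  simpa using h

/-! ### Orders and leading terms -/

/-- The differential polynomials of order less than `m`. -/
def orderLT (m : ℕ) : Subalgebra ℝ DiffPoly := supported ℝ {s | s.2 < m}

theorem orderLT_mono {m l : ℕ} (h : m ≤ l) : orderLT m ≤ orderLT l :=
  supported_mono fun _ hs => lt_of_lt_of_le hs h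

theorem X_mem_orderLT {s : Fin 2 × ℕ} {m : ℕ} (h : s.2 < m) : X s ∈ orderLT m :=
  X_mem_supported.2 h

theorem C_mem_orderLT (t : ℝ) (m : ℕ) : C t ∈ orderLT m := (orderLT m).algebraMap_mem t

theorem D_mem_orderLT {f : DiffPoly} {m : ℕ} (h : f ∈ orderLT m) : D f ∈ orderLT (m + 1) := by
  induction h using Algebra.adjoin_induction with
  | mem x hx =>
    obtain ⟨s, hs, rfl⟩ := hx
    rw [D, mkDerivation_X]
    exact X_mem_orderLT (Nat.succ_lt_succ hs)
  | algebraMap t => simp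
  | add x y _ _ hx hy => rw [map_add]; exact add_mem hx hy
  | mul x y hx hy hx' hy' =>
    rw [Derivation.leibniz, smul_eq_mul, smul_eq_mul]
    exact add_mem (mul_mem (orderLT_mono m.le_succ hx) hy')
      (mul_mem (orderLT_mono m.le_succ hy) hx')

/-- The leading terms of `b_{k+1}` and `c_{k+1}` are constant multiples of `q_{kx}` and `r_{kx}`,
while `a_{k+1}` has lower order. -/
theorem leading_terms (k : ℕ) : a (k + 1) ∈ orderLT k ∧
    b (k + 1) - C (-2 * (-1 / 2) ^ k) * X (0, k) ∈ orderLT k ∧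
    c (k + 1) - C (2 * (1 / 2) ^ k) * X (1, k) ∈ orderLT k := by
  induction k using Nat.strong_induction_on with
  | _ k ih =>
    have hb : ∀ i < k, b (i + 1) ∈ orderLT k := fun i hi => by
      have := add_mem (orderLT_mono hi.le (ih i hi).2.1)
        (mul_mem (C_mem_orderLT (-2 * (-1 / 2) ^ i) k) (X_mem_orderLT (s := (0, i)) hi))
      rwa [sub_add_cancel] at this
    have hc : ∀ i < k, c (i + 1) ∈ orderLT k := fun i hi => by
      have := add_mem (orderLT_mono hi.le (ih i hi).2.2)
        (mul_mem (C_mem_orderLT (2 * (1 / 2) ^ i) k) (X_mem_orderLT (s := (1, i)) hi))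
      rwa [sub_add_cancel] at this
    have ha : ∀ i < k, a (i + 1) ∈ orderLT k := fun i hi => orderLT_mono hi.le (ih i hi).1
    rcases k with _ | k
    · rw [zero_add, a_one, b_one, c_one]
      refine ⟨zero_mem _, ?_, ?_⟩
      · convert zero_mem (orderLT 0) using 1
        rw [q, pow_zero, mul_one, map_neg, map_ofNat, sub_self]
      · convert zero_mem (orderLT 0) using 1
        rw [r, pow_zero, mul_one, map_ofNat, sub_self]
    · refine ⟨?_, ?_, ?_⟩
      · have h4 : a (k + 2) = C (1 / 4) * (4 * a (k + 2)) := by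
          rw [← map_ofNat (C (σ := Fin 2 × ℕ) (R := ℝ)) 4, ← mul_assoc, ← C_mul]; norm_num
        rw [h4, four_mul_a]
        refine mul_mem (C_mem_orderLT _ _) (sum_mem fun p hp => ?_)
        have := Finset.HasAntidiagonal.mem_antidiagonal.1 hp
        exact sub_mem (mul_mem (ha _ (by omega)) (ha _ (by omega)))
          (mul_mem (hb _ (by omega)) (hc _ (by omega)))
      · have h := D_mem_orderLT (ih k k.lt_succ_self).2.1
        rw [map_sub, derivation_const_mul, D, mkDerivation_X, ← D] at h
        have := add_mem (mul_mem (C_mem_orderLT (-1 / 2) _) h)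
          (mul_mem (X_mem_orderLT (s := (0, 0)) k.succ_pos) (ha k k.lt_succ_self))
        convert this using 1
        rw [b_succ (Nat.le_add_left 1 k), q, pow_succ, ← map_neg C]
        simp only [map_mul, map_pow, neg_div]
        ring
      · have h := D_mem_orderLT (ih k k.lt_succ_self).2.2
        rw [map_sub, derivation_const_mul, D, mkDerivation_X, ← D] at h
        have := sub_mem (mul_mem (C_mem_orderLT (1 / 2) _) h)
          (mul_mem (X_mem_orderLT (s := (1, 0)) k.succ_pos) (ha k k.lt_succ_self))
        convert this using 1
        rw [c_succ (Nat.le_add_left 1 k), r, pow_succ]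
        simp only [map_mul, map_pow]
        ring

/-- The coefficients of the leading terms of `b_{k+1}` and `c_{k+1}`. -/
def lead (k : ℕ) (i : Fin 2) : ℝ := if i = 0 then -2 * (-1 / 2) ^ k else 2 * (1 / 2) ^ k

theorem lead_ne_zero (k : ℕ) (i : Fin 2) : lead k i ≠ 0 := by
  unfold lead; split_ifs <;> positivity

/-- The difference of `evolField (k + 1) s` and its leading term. -/
def lowerTerm (k : ℕ) (s : Fin 2 × ℕ) : DiffPoly :=
  evolField (k + 1) s - C (lead k s.1) * X (s.1, k + s.2)

theorem evolField_succ (k : ℕ) (i : Fin 2) (m : ℕ) :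
    evolField k (i, m + 1) = D (evolField k (i, m)) := by
  simp only [evolField, Function.iterate_succ_apply']

theorem lowerTerm_mem (k : ℕ) (s : Fin 2 × ℕ) : lowerTerm k s ∈ orderLT (k + s.2) := by
  obtain ⟨i, m⟩ := s
  induction m with
  | zero =>
    obtain ⟨-, hb, hc⟩ := leading_terms k
    by_cases hi : i = 0
    · subst hi; simpa [lowerTerm, evolField, lead] using hb
    · obtain rfl : i = 1 := by omega
      simpa [lowerTerm, evolField, lead] using hc
  | succ m ih =>
    have e : lowerTerm k (i, m + 1) = D (lowerTerm k (i, m)) := by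
      simp only [lowerTerm]
      rw [map_sub, derivation_const_mul, evolField_succ]
      simp only [D, mkDerivation_X]
      rfl
    rw [e]
    exact D_mem_orderLT ih

/-! ### The commuting flows -/

/-- The derivation along the evolutionary vector field of `K_k`. -/
def evolD (k : ℕ) : Derivation ℝ DiffPoly DiffPoly := mkDerivation ℝ (evolField k)

theorem evolD_comm_D (k : ℕ) (f : DiffPoly) : evolD k (D f) = D (evolD k f) := by
  have h : (⁅evolD k, D⁆ : Derivation ℝ DiffPoly DiffPoly) = 0 := by
    refine MvPolynomial.derivation_ext fun s => ?_
    rw [Derivation.commutator_apply]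
    simp only [D, evolD, mkDerivation_X]
    rw [← D, evolField_succ]
    simp
  have := congrArg (fun d => d f) h
  rw [Derivation.commutator_apply] at this
  exact sub_eq_zero.1 this

theorem evolD_q (k : ℕ) : evolD k q = b k := by
  simp [evolD, q, mkDerivation_X, evolField]

theorem evolD_r (k : ℕ) : evolD k r = c k := by
  simp [evolD, r, mkDerivation_X, evolField]

theorem coeff_lowPart_mul {R : Type*} [CommRing R] (f g : PowerSeries R) {k l M : ℕ}
    (h : k + l + 1 = M) : PowerSeries.coeff M (lowPart l f * g) =
      PowerSeries.coeff M (f * g) - PowerSeries.coeff M (f * lowPart k g) := by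
  simp only [PowerSeries.coeff_mul, coeff_lowPart, ← Finset.sum_sub_distrib]
  refine Finset.sum_congr rfl fun p hp => ?_
  have := Finset.HasAntidiagonal.mem_antidiagonal.1 hp
  by_cases hl : p.1 ≤ l
  · rw [if_pos hl, if_neg (by omega)]; ring
  · rw [if_neg hl, if_pos (by omega)]; ring

/-- At order `k + l + 1` the commutators with the truncations at `k` and at `l` have the same
entries. This symmetry in `k` and `l` is the reason that the flows commute. -/
theorem coeff_lowPart_bracket {R : Type*} [CommRing R] (f g : PowerSeries R) {k l M : ℕ}
    (h : k + l + 1 = M) : PowerSeries.coeff M (lowPart l f * g - f * lowPart l g) =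
      PowerSeries.coeff M (lowPart k f * g - f * lowPart k g) := by
  rw [map_sub, map_sub, coeff_lowPart_mul f g h,
    coeff_lowPart_mul f g (show l + k + 1 = M by omega)]
  ring

/-- The flow of `K_{k+1}` as a Lax equation on all jets. -/
theorem evolD_bc (k m : ℕ) :
    evolD (k + 1) (b (m + 1)) =
      PowerSeries.coeff (k + m + 1) (lowPart k serA * serB - serA * lowPart k serB) ∧
    evolD (k + 1) (c (m + 1)) =
      PowerSeries.coeff (k + m + 1) (lowPart k serC * serA - serC * lowPart k serA) := by
  have h := laxSolution.flow (δ := evolD (k + 1)) (k := k) (N := m + 1) (evolD_comm_D _)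
    (by rw [evolD_q, coeff_succ_serB]) (by rw [evolD_r, coeff_succ_serC])
    (fun l _ => by
      rw [det_eq, PowerSeries.coeff_C]
      split_ifs
      · rw [← map_ofNat (C (σ := Fin 2 × ℕ) (R := ℝ)) 4, derivation_C]
      · simp) (k + m + 1) (by omega)
  rw [← h.2.1, ← h.2.2, show k + m + 1 = m + 1 + k by omega, PowerSeries.coeff_X_pow_mul,
    PowerSeries.coeff_X_pow_mul]
  simp

theorem evolD_b_comm (k m : ℕ) : evolD (k + 1) (b (m + 1)) = evolD (m + 1) (b (k + 1)) := by
  rw [(evolD_bc k m).1, (evolD_bc m k).1, add_comm m k]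
  exact coeff_lowPart_bracket _ _ (by omega)

theorem evolD_c_comm (k m : ℕ) : evolD (k + 1) (c (m + 1)) = evolD (m + 1) (c (k + 1)) := by
  rw [(evolD_bc k m).2, (evolD_bc m k).2, add_comm m k]
  exact coeff_lowPart_bracket _ _ (by omega)

/-- The flows of the hierarchy commute. -/
theorem evolD_evolField_comm (k m : ℕ) (s : Fin 2 × ℕ) :
    evolD (k + 1) (evolField (m + 1) s) = evolD (m + 1) (evolField (k + 1) s) := by
  obtain ⟨i, l⟩ := s
  induction l with
  | zero =>
    by_cases hi : i = 0
    · subst hi; simpa [evolField] using evolD_b_comm k m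
    · obtain rfl : i = 1 := by omega
      simpa [evolField] using evolD_c_comm k m
  | succ l ih => rw [evolField_succ, evolField_succ, evolD_comm_D, evolD_comm_D, ih]

end Hierarchy

/-! ### Derivatives of polynomial functions -/

section PolynomialFunctions

open MvPolynomial

variable {σ : Type*} [Fintype σ]

theorem contDiff_eval (f : MvPolynomial σ ℝ) {m : WithTop ℕ∞} :
    ContDiff ℝ m fun y : σ → ℝ => eval y f :=
  ((AnalyticOnNhd.eval_mvPolynomial f).contDiff).of_le le_top

theorem differentiableAt_eval (f : MvPolynomial σ ℝ) (y : σ → ℝ) :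
    DifferentiableAt ℝ (fun y : σ → ℝ => eval y f) y :=
  (contDiff_eval f (m := 1)).differentiable one_ne_zero y

/-- The derivative of a polynomial function along the vector field of a derivation. -/
theorem fderiv_eval (δ : Derivation ℝ (MvPolynomial σ ℝ) (MvPolynomial σ ℝ)) (y : σ → ℝ)
    (f : MvPolynomial σ ℝ) :
    fderiv ℝ (fun y : σ → ℝ => eval y f) y (fun s => eval y (δ (X s))) = eval y (δ f) := by
  induction f using MvPolynomial.induction_on with
  | C t => simp [derivation_C]
  | add f g hf hg =>
    have : (fun y : σ → ℝ => eval y (f + g)) = (fun y => eval y f) + fun y => eval y g := by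
      ext; simp
    rw [this, fderiv_add (differentiableAt_eval f y) (differentiableAt_eval g y)]
    simp [hf, hg]
  | mul_X f s hf =>
    have : (fun y : σ → ℝ => eval y (f * X s)) = (fun y => eval y f) * fun y => y s := by
      ext; simp
    rw [this, fderiv_mul (differentiableAt_eval f y) (differentiableAt_apply s y)]
    simp [hf, Derivation.leibniz, fderiv_apply]

end PolynomialFunctions

/-! ### The stationary manifold -/

section Stationary

open MvPolynomial

/-- Polynomials in the jet coordinates of order less than `n`. -/
abbrev LowPoly (n : ℕ) : Type := MvPolynomial (Fin 2 × Fin n) ℝ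

/-- The jet coordinates on the stationary manifold as polynomials in those of order less
than `n`, obtained by solving the equations `∂_x^m K_{n+1} = 0` for their leading terms. -/
def jetPoly (n : ℕ) (s : Fin 2 × ℕ) : LowPoly n :=
  if h : s.2 < n then X (s.1, ⟨s.2, h⟩)
  else C (-(lead n s.1)⁻¹) * aeval (fun t : Fin 2 × ℕ => if _ : t.2 < s.2 then jetPoly n t else 0)
    (lowerTerm n (s.1, s.2 - n))
termination_by s.2

/-- Restriction of differential polynomials to the stationary manifold. -/
def restr (n : ℕ) : DiffPoly →ₐ[ℝ] LowPoly n := aeval (jetPoly n)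

theorem algHom_eq_of_mem_orderLT {A : Type*} [CommRing A] [Algebra ℝ A] {φ χ : DiffPoly →ₐ[ℝ] A}
    {m : ℕ} (h : ∀ t : Fin 2 × ℕ, t.2 < m → φ (X t) = χ (X t)) {f : DiffPoly}
    (hf : f ∈ orderLT m) : φ f = χ f := by
  induction hf using Algebra.adjoin_induction with
  | mem x hx => obtain ⟨t, ht, rfl⟩ := hx; exact h t ht
  | algebraMap t => rw [φ.commutes, χ.commutes]
  | add x y _ _ hx hy => rw [map_add, map_add, hx, hy]
  | mul x y _ _ hx hy => rw [map_mul, map_mul, hx, hy]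

theorem restr_X_low {n : ℕ} (s : Fin 2 × Fin n) : restr n (X (s.1, (s.2 : ℕ))) = X s := by
  rw [restr, aeval_X, jetPoly, dif_pos s.2.2]

theorem evolField_eq (n : ℕ) (s : Fin 2 × ℕ) :
    evolField (n + 1) s = lowerTerm n s + C (lead n s.1) * X (s.1, n + s.2) := by
  rw [lowerTerm, sub_add_cancel]

theorem restr_evolField (n : ℕ) (s : Fin 2 × ℕ) : restr n (evolField (n + 1) s) = 0 := by
  have h : restr n (X (s.1, n + s.2)) = C (-(lead n s.1)⁻¹) * restr n (lowerTerm n s) := by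
    rw [restr, aeval_X, jetPoly, dif_neg (by dsimp; omega)]
    dsimp only
    rw [Nat.add_sub_cancel_left]
    congr 1
    refine algHom_eq_of_mem_orderLT (fun t ht => ?_) (lowerTerm_mem n s)
    rw [aeval_X, aeval_X, dif_pos ht]
  have hl : restr n (C (lead n s.1)) = C (lead n s.1) := (restr n).commutes _
  rw [evolField_eq, map_add, map_mul, h, hl, ← mul_assoc, ← C_mul, mul_neg,
    mul_inv_cancel₀ (lead_ne_zero n s.1)]
  simp

/-- Points of the stationary manifold are determined by their jet coordinates of order less
than `n`. -/
theorem algHom_ext_of_stationary {A : Type*} [CommRing A] [Algebra ℝ A] [IsDomain A]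
    {φ χ : DiffPoly →ₐ[ℝ] A} {n : ℕ} (hφ : ∀ s, φ (evolField (n + 1) s) = 0)
    (hχ : ∀ s, χ (evolField (n + 1) s) = 0)
    (h : ∀ s : Fin 2 × ℕ, s.2 < n → φ (X s) = χ (X s)) : φ = χ := by
  have main : ∀ m i, φ (X (i, m)) = χ (X (i, m)) := by
    intro m
    induction m using Nat.strong_induction_on with
    | _ m ih =>
      intro i
      by_cases hm : m < n
      · exact h _ hm
      · obtain ⟨l, rfl⟩ := Nat.exists_eq_add_of_le (not_lt.1 hm)
        have h1 := hφ (i, l)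
        have h2 := hχ (i, l)
        have h3 := algHom_eq_of_mem_orderLT (φ := φ) (χ := χ)
          (fun t ht => ih t.2 ht t.1) (lowerTerm_mem n (i, l))
        have hC : algebraMap ℝ A (lead n i) ≠ 0 := by
          rw [Ne, map_eq_zero_iff _ (FaithfulSMul.algebraMap_injective ℝ A)]
          exact lead_ne_zero n i
        have hφC : φ (C (lead n i)) = algebraMap ℝ A (lead n i) := φ.commutes _
        have hχC : χ (C (lead n i)) = algebraMap ℝ A (lead n i) := χ.commutes _
        rw [evolField_eq, map_add, map_mul, hφC] at h1
        rw [evolField_eq, map_add, map_mul, hχC] at h2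
        apply mul_left_cancel₀ hC
        linear_combination h1 - h2 - h3
  exact MvPolynomial.algHom_ext fun s => main s.2 s.1

/-- The derivation of `LowPoly n` that a derivation of the differential polynomials induces on
the stationary manifold if it is tangent to it. -/
def restrD (n : ℕ) (E : Derivation ℝ DiffPoly DiffPoly) : Derivation ℝ (LowPoly n) (LowPoly n) :=
  mkDerivation ℝ fun s => restr n (E (X (s.1, (s.2 : ℕ))))

/-- A derivation `E` with `E (∂_x^m K_{n+1}) = 0` on the stationary manifold is tangent to it. -/
theorem restr_derivation {n : ℕ} {E : Derivation ℝ DiffPoly DiffPoly}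
    (hE : ∀ s, restr n (E (evolField (n + 1) s)) = 0) (f : DiffPoly) :
    restr n (E f) = restrD n E (restr n f) := by
  have ext : ∀ m, (∀ t : Fin 2 × ℕ, t.2 < m → restr n (E (X t)) = restrD n E (restr n (X t))) →
      ∀ f ∈ orderLT m, restr n (E f) = restrD n E (restr n f) := by
    intro m h f hf
    induction hf using Algebra.adjoin_induction with
    | mem x hx => obtain ⟨t, ht, rfl⟩ := hx; exact h t ht
    | algebraMap t => simp
    | add x y _ _ hx hy => simp only [map_add, hx, hy]
    | mul x y _ _ hx hy => simp only [Derivation.leibniz, smul_eq_mul, map_add, map_mul, hx, hy]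
  have gen : ∀ m i, restr n (E (X (i, m))) = restrD n E (restr n (X (i, m))) := by
    intro m
    induction m using Nat.strong_induction_on with
    | _ m ih =>
      intro i
      by_cases hm : m < n
      · have := restr_X_low (i, ⟨m, hm⟩)
        dsimp only at this
        rw [this, restrD, mkDerivation_X]
      · obtain ⟨l, rfl⟩ := Nat.exists_eq_add_of_le (not_lt.1 hm)
        have h1 := hE (i, l)
        have h2 := congrArg (restrD n E) (restr_evolField n (i, l))
        have h3 := ext _ (fun t ht => ih t.2 ht t.1) _ (lowerTerm_mem n (i, l))
        have hC : (C (lead n i) : LowPoly n) ≠ 0 := by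
          rw [Ne, C_eq_zero]; exact lead_ne_zero n i
        have hl : restr n (C (lead n i)) = C (lead n i) := (restr n).commutes _
        rw [evolField_eq, map_add, map_add, derivation_const_mul, map_mul, hl] at h1
        rw [evolField_eq, map_add, map_add, map_mul, hl, derivation_const_mul, map_zero] at h2
        apply mul_left_cancel₀ hC
        linear_combination h1 - h2 - h3
  induction f using MvPolynomial.induction_on with
  | C t => simp [derivation_C, restr]
  | add f g hf hg => simp only [map_add, hf, hg]
  | mul_X f s hf =>
    simp only [Derivation.leibniz, smul_eq_mul, map_add, map_mul, hf]
    rw [gen s.2 s.1]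

theorem restr_D {n : ℕ} (f : DiffPoly) : restr n (D f) = restrD n D (restr n f) :=
  restr_derivation (fun s => by rw [← evolField_succ, restr_evolField]) f

/-- The flow of `K_{n+1}` vanishes on the stationary manifold. -/
theorem restr_evolD_self (n : ℕ) (f : DiffPoly) : restr n (evolD (n + 1) f) = 0 := by
  induction f using MvPolynomial.induction_on with
  | C t => simp [derivation_C]
  | add f g hf hg => rw [map_add, map_add, hf, hg, add_zero]
  | mul_X f s hf =>
    rw [Derivation.leibniz, evolD, mkDerivation_X, ← evolD, smul_eq_mul, smul_eq_mul, map_add,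
      map_mul, map_mul, hf, restr_evolField]
    simp

/-- The flows are tangent to the stationary manifold, since they commute with that
of `K_{n+1}`. -/
theorem restr_evolD {n : ℕ} (k : ℕ) (f : DiffPoly) :
    restr n (evolD (k + 1) f) = restrD n (evolD (k + 1)) (restr n f) :=
  restr_derivation (fun s => by rw [evolD_evolField_comm, restr_evolD_self]) f

/-- The parametrization of the stationary manifold by the jet coordinates of order less
than `n`. -/
def jetMap (n : ℕ) (y : LowJet n) : Jet := fun s => eval y (jetPoly n s)

theorem eval_jetMap (n : ℕ) (y : LowJet n) (f : DiffPoly) :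
    eval (jetMap n y) f = eval y (restr n f) := by
  have : (aeval (jetMap n y) : DiffPoly →ₐ[ℝ] ℝ) = (aeval y).comp (restr n) := by
    refine MvPolynomial.algHom_ext fun s => ?_
    simp [jetMap, restr, aeval_eq_eval]
  simpa [aeval_eq_eval] using congrArg (fun φ => φ f) this

theorem jetMap_mem (n : ℕ) (y : LowJet n) : jetMap n y ∈ stationary n := fun s => by
  rw [eval_jetMap, restr_evolField, map_zero]

theorem jetCoords_jetMap (n : ℕ) (y : LowJet n) : jetCoords n (jetMap n y) = y := by
  ext s
  have := eval_jetMap n y (X (s.1, (s.2 : ℕ)))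
  rwa [restr_X_low, eval_X, eval_X] at this

theorem jetMap_jetCoords {n : ℕ} {z : Jet} (hz : z ∈ stationary n) :
    jetMap n (jetCoords n z) = z := by
  have h : (aeval (jetMap n (jetCoords n z)) : DiffPoly →ₐ[ℝ] ℝ) = aeval z := by
    refine algHom_ext_of_stationary (n := n) (fun s => ?_) (fun s => ?_) fun s hs => ?_
    · simpa [aeval_eq_eval] using jetMap_mem n (jetCoords n z) s
    · simpa [aeval_eq_eval] using hz s
    · rw [aeval_X, aeval_X]
      exact congrArg (fun y : LowJet n => y (s.1, ⟨s.2, hs⟩)) (jetCoords_jetMap n (jetCoords n z))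
  ext s
  simpa using congrArg (fun φ => φ (X s)) h

/-- Derivatives along the restricted flow are given by the induced derivation. -/
theorem fderiv_restrictedField (n k : ℕ) (y : LowJet n) (f : LowPoly n) :
    fderiv ℝ (fun y' : LowJet n => eval y' f) y (restrictedField n k (jetMap n y)) =
      eval y (restrD n (evolD k) f) := by
  rw [← fderiv_eval]
  congr 1
  ext s
  rw [restrictedField, eval_jetMap, restrD, mkDerivation_X, evolD, mkDerivation_X]

/-! ### The Lax matrix on the stationary manifold -/

/-- The restriction of the truncated series `∑_{i ≤ n} a_i zⁱ` to the stationary manifold. -/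
def stA (n : ℕ) : PowerSeries (LowPoly n) := lowPart n (serA.map (restr n : DiffPoly →+* LowPoly n))

/-- The restriction of the truncated series `∑_{i ≤ n} b_i zⁱ` to the stationary manifold. -/
def stB (n : ℕ) : PowerSeries (LowPoly n) := lowPart n (serB.map (restr n : DiffPoly →+* LowPoly n))

/-- The restriction of the truncated series `∑_{i ≤ n} c_i zⁱ` to the stationary manifold. -/
def stC (n : ℕ) : PowerSeries (LowPoly n) := lowPart n (serC.map (restr n : DiffPoly →+* LowPoly n))

theorem map_coeffD {n : ℕ} (f : PowerSeries DiffPoly) :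
    (coeffD D f).map (restr n : DiffPoly →+* LowPoly n) =
      coeffD (restrD n D) (f.map (restr n : DiffPoly →+* LowPoly n)) := by
  ext1 i
  simp only [PowerSeries.coeff_map, coeff_coeffD]
  exact restr_D _

/-- Restriction to the stationary manifold commutes with `∂_x`, so it preserves Lax solutions. -/
theorem laxSolution_map (n : ℕ) : LaxSolution (restrD n D) (restr n q) (restr n r)
    (serA.map (restr n : DiffPoly →+* LowPoly n)) (serB.map (restr n : DiffPoly →+* LowPoly n))
    (serC.map (restr n : DiffPoly →+* LowPoly n)) := by
  constructor
  · have h := congrArg (PowerSeries.map (restr n : DiffPoly →+* LowPoly n)) serA_eq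
    rw [map_coeffD, map_add, map_mul, map_mul, PowerSeries.map_C, PowerSeries.map_C] at h
    exact h
  · have h := congrArg (PowerSeries.map (restr n : DiffPoly →+* LowPoly n)) serB_eq
    rw [map_sub, map_mul, map_mul, map_mul, map_mul, map_mul, PowerSeries.map_C, map_coeffD,
      PowerSeries.map_X, map_ofNat] at h
    exact h
  · have h := congrArg (PowerSeries.map (restr n : DiffPoly →+* LowPoly n)) serC_eq
    rw [map_add, map_mul, map_mul, map_mul, map_mul, map_mul, PowerSeries.map_C, map_coeffD,
      PowerSeries.map_X, map_ofNat] at h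
    exact h
  · rw [PowerSeries.coeff_map, coeff_zero_serA, map_neg, map_ofNat]

/-- The truncated series solve the Lax equation on the stationary manifold, where
`b_{n+1} = c_{n+1} = 0`. -/
theorem laxSolution_stationary (n : ℕ) :
    LaxSolution (restrD n D) (restr n q) (restr n r) (stA n) (stB n) (stC n) := by
  obtain ⟨h1, h2, h3⟩ := (laxSolution_map n).lowPart_eqs n
  have hb : restr n (b (n + 1)) = 0 := by simpa [evolField] using restr_evolField n (0, 0)
  have hc : restr n (c (n + 1)) = 0 := by simpa [evolField] using restr_evolField n (1, 0)
  constructor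
  · exact h1
  · simpa [hb, stA, stB] using h2
  · simpa [hc, stA, stC] using h3
  · simpa [stA, -PowerSeries.coeff_zero_eq_constantCoeff] using (laxSolution_map n).zero_a

theorem coeff_lowPart_mul_lowPart {R : Type*} [CommRing R] (f g : PowerSeries R) {m n : ℕ}
    (h : m ≤ n) :
    PowerSeries.coeff m (lowPart n f * lowPart n g) = PowerSeries.coeff m (f * g) := by
  simp only [PowerSeries.coeff_mul, coeff_lowPart]
  refine Finset.sum_congr rfl fun p hp => ?_
  have := Finset.HasAntidiagonal.mem_antidiagonal.1 hp
  rw [if_pos (by omega), if_pos (by omega)]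

/-- Truncation at `n` does not affect the coefficients of `a² - b c = 4` up to order `n`. -/
theorem coeff_det_stationary {n m : ℕ} (h : m ≤ n) :
    PowerSeries.coeff m (stA n * stA n - stB n * stC n) = if m = 0 then 4 else 0 := by
  rw [map_sub, stA, stB, stC, coeff_lowPart_mul_lowPart _ _ h, coeff_lowPart_mul_lowPart _ _ h,
    ← map_sub, ← map_mul, ← map_mul, ← map_sub, det_eq, PowerSeries.map_C, PowerSeries.coeff_C,
    map_ofNat]

/-- The flow of `K_{k+1}` on the stationary manifold as a Lax equation. -/
theorem stationary_flow {n k : ℕ} (hk : k < n) :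
    ∀ m ≤ n + k,
      PowerSeries.coeff m (2 * (PowerSeries.X ^ k * coeffD (restrD n (evolD (k + 1))) (stA n))) =
        PowerSeries.coeff m (stB n * lowPart k (stC n) - lowPart k (stB n) * stC n) ∧
      PowerSeries.coeff m (PowerSeries.X ^ k * coeffD (restrD n (evolD (k + 1))) (stB n)) =
        PowerSeries.coeff m (lowPart k (stA n) * stB n - stA n * lowPart k (stB n)) ∧
      PowerSeries.coeff m (PowerSeries.X ^ k * coeffD (restrD n (evolD (k + 1))) (stC n)) =
        PowerSeries.coeff m (lowPart k (stC n) * stA n - stC n * lowPart k (stA n)) := by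
  refine (laxSolution_stationary n).flow (fun f => ?_) ?_ ?_ fun m hm => ?_
  · have h : (⁅restrD n (evolD (k + 1)), restrD n D⁆ :
        Derivation ℝ (LowPoly n) (LowPoly n)) = 0 := by
      refine MvPolynomial.derivation_ext fun s => ?_
      rw [Derivation.commutator_apply, ← restr_X_low s, ← restr_evolD, ← restr_D, ← restr_evolD,
        ← restr_D, evolD_comm_D, sub_self]
      rfl
    have := congrArg (fun d => d f) h
    rw [Derivation.commutator_apply] at this
    exact sub_eq_zero.1 this
  · rw [← restr_evolD, evolD_q, stB, coeff_lowPart, if_pos (by omega), PowerSeries.coeff_map,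
      coeff_succ_serB]
    rfl
  · rw [← restr_evolD, evolD_r, stC, coeff_lowPart, if_pos (by omega), PowerSeries.coeff_map,
      coeff_succ_serC]
    rfl
  · rw [coeff_det_stationary hm]
    split_ifs
    · rw [← map_ofNat (C (σ := Fin 2 × Fin n) (R := ℝ)) 4, derivation_C]
    · simp

end Stationary

/-! ### Residues modulo the Viète polynomial -/

section Viete

open Polynomial

variable {R : Type*} [CommRing R] {n : ℕ}

/-- The polynomial `∑ u_i λ^{n-i}` of degree less than `n` with coefficient vector `u`. -/
def vecPoly (u : Fin n → R) : R[X] := ∑ i : Fin n, C (u i) * X ^ (n - 1 - (i : ℕ))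

theorem coeff_vecPoly (u : Fin n → R) (m : ℕ) :
    (vecPoly u).coeff m = if h : m < n then u ⟨n - 1 - m, by omega⟩ else 0 := by
  simp only [vecPoly, finsetSum_coeff, coeff_C_mul, coeff_X_pow]
  split_ifs with h
  · rw [Finset.sum_eq_single ⟨n - 1 - m, by omega⟩]
    · rw [if_pos (by dsimp; omega), mul_one]
    · intro i _ hi
      rw [if_neg, mul_zero]
      exact fun hm => hi (Fin.ext (by dsimp; omega))
    · simp
  · refine Finset.sum_eq_zero fun i _ => ?_
    rw [if_neg (by omega), mul_zero]

theorem degree_vecPoly_lt (u : Fin n → R) : (vecPoly u).degree < n :=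
  (degree_lt_iff_coeff_zero _ _).2 fun m hm => by rw [coeff_vecPoly, dif_neg (by omega)]

theorem eq_vecPoly {f : R[X]} (hf : f.degree < n) :
    f = vecPoly fun i : Fin n => f.coeff (n - 1 - (i : ℕ)) := by
  ext m
  rw [coeff_vecPoly]
  split_ifs with h
  · congr 1; dsimp; omega
  · exact (degree_lt_iff_coeff_zero _ _).1 hf m (by omega)

/-- The polynomial part of `λ^{k-n} Q`, where `Q = λⁿ + ∑ x_i λ^{n-i}`, for `k ≤ n`. -/
def headPoly (x : Fin n → R) (k : ℕ) : R[X] :=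
  X ^ k + ∑ i : Fin n, if (i : ℕ) < k then C (x i) * X ^ (k - 1 - (i : ℕ)) else 0

/-- The polynomial `Q = λⁿ + ∑ x_i λ^{n-i}` with Viète coordinates `x`. -/
def vietePoly (x : Fin n → R) : R[X] := headPoly x n

theorem vietePoly_eq (x : Fin n → R) : vietePoly x = X ^ n + vecPoly x := by
  simp [vietePoly, headPoly, vecPoly]

theorem coeff_headPoly_of_le (x : Fin n → R) {k m : ℕ} (h : k ≤ m) :
    (headPoly x k).coeff m = if m = k then 1 else 0 := by
  rw [headPoly, coeff_add, coeff_X_pow, finsetSum_coeff, Finset.sum_eq_zero, add_zero]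
  intro i _
  split_ifs with hi
  · rw [coeff_C_mul, coeff_X_pow, if_neg (by omega), mul_zero]
  · simp

theorem coeff_headPoly_of_lt (x : Fin n → R) {k m : ℕ} (h : m < k) (hk : k ≤ n) :
    (headPoly x k).coeff m = x ⟨k - 1 - m, by omega⟩ := by
  rw [headPoly, coeff_add, coeff_X_pow, if_neg (by omega), zero_add, finsetSum_coeff,
    Finset.sum_eq_single ⟨k - 1 - m, by omega⟩, if_pos (by dsimp; omega), coeff_C_mul,
    coeff_X_pow, if_pos (by dsimp; omega), mul_one]
  · intro i _ hi
    split_ifs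
    · rw [coeff_C_mul, coeff_X_pow, if_neg, mul_zero]
      exact fun hm => hi (Fin.ext (by dsimp; omega))
    · simp
  · simp

theorem degree_headPoly_lt (x : Fin n → R) (k : ℕ) : (headPoly x k).degree < (k + 1 : ℕ) :=
  (degree_lt_iff_coeff_zero _ _).2 fun m hm => by
    rw [coeff_headPoly_of_le x (by omega), if_neg (by omega)]

theorem monic_vietePoly (x : Fin n → R) : (vietePoly x).Monic := by
  rw [vietePoly_eq]
  exact monic_X_pow_add (degree_vecPoly_lt x)

/-- The functional `f ↦ Res (f / Q)`: the coefficient at `λ^{n-1}` of the remainder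
of `f` modulo `Q`. For `n = 0` it vanishes, all remainders modulo `Q = 1` being `0`. -/
def residue (x : Fin n → R) : R[X] →ₗ[R] R :=
  (lcoeff R (n - 1)).comp (modByMonicHom (vietePoly x))

theorem residue_apply (x : Fin n → R) (f : R[X]) :
    residue x f = (f %ₘ vietePoly x).coeff (n - 1) := rfl

theorem residue_C_mul (x : Fin n → R) (t : R) (f : R[X]) :
    residue x (C t * f) = t * residue x f := by
  rw [← smul_eq_C_mul, map_smul, smul_eq_mul]

theorem residue_vietePoly_mul (x : Fin n → R) (f : R[X]) : residue x (vietePoly x * f) = 0 := by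
  rw [residue_apply, (modByMonic_eq_zero_iff_dvd (monic_vietePoly x)).2 (dvd_mul_right _ _),
    coeff_zero]

theorem residue_mul_mod (x : Fin n → R) (f g : R[X]) :
    residue x (g * (f %ₘ vietePoly x)) = residue x (g * f) := by
  conv_rhs => rw [← modByMonic_add_div f (vietePoly x), mul_add, map_add, mul_left_comm,
    residue_vietePoly_mul, add_zero]

/-- The head `headPoly x k` agrees with `λ^{k-n} Q` up to negative powers of `λ`. -/
theorem headPoly_tail (x : Fin n → R) {k : ℕ} (hk : k ≤ n) :
    (vietePoly x - X ^ (n - k) * headPoly x k).degree < ((n - k : ℕ) : WithBot ℕ) := by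
  have : vietePoly x - X ^ (n - k) * headPoly x k =
      ∑ i : Fin n, if (i : ℕ) < k then 0 else C (x i) * X ^ (n - 1 - (i : ℕ)) := by
    rw [vietePoly, headPoly, headPoly, mul_add, ← pow_add, Nat.sub_add_cancel hk,
      add_sub_add_left_eq_sub, Finset.mul_sum, ← Finset.sum_sub_distrib]
    refine Finset.sum_congr rfl fun i _ => ?_
    rw [if_pos i.2]
    split_ifs with h
    · rw [mul_left_comm, ← pow_add, show n - k + (k - 1 - (i : ℕ)) = n - 1 - i by omega, sub_self]
    · rw [mul_zero, sub_zero]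
  rw [this, degree_lt_iff_coeff_zero]
  intro m hm
  rw [finsetSum_coeff]
  refine Finset.sum_eq_zero fun i _ => ?_
  split_ifs with h
  · simp
  · rw [coeff_C_mul, coeff_X_pow, if_neg (by omega), mul_zero]

theorem degree_X_pow_mul_lt {f : R[X]} {d e m : ℕ} (hf : f.degree < (d : WithBot ℕ))
    (h : e + d ≤ m) : (X ^ e * f).degree < (m : WithBot ℕ) := by
  rw [degree_lt_iff_coeff_zero] at hf ⊢
  intro l hl
  rw [coeff_X_pow_mul', if_pos (by omega)]
  exact hf _ (by omega)

section

variable [Nontrivial R]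

theorem degree_vietePoly (x : Fin n → R) : (vietePoly x).degree = n := by
  rw [vietePoly_eq]
  rw [degree_add_eq_left_of_degree_lt, degree_X_pow]
  rw [degree_X_pow]
  exact degree_vecPoly_lt x

theorem residue_of_degree_lt (x : Fin n → R) {f : R[X]} (hf : f.degree < n) :
    residue x f = f.coeff (n - 1) := by
  rw [residue_apply, (modByMonic_eq_self_iff (monic_vietePoly x)).2]
  rwa [degree_vietePoly]

theorem degree_mod_lt (x : Fin n → R) (f : R[X]) : (f %ₘ vietePoly x).degree < n := by
  rw [← degree_vietePoly x]
  exact degree_modByMonic_lt _ (monic_vietePoly x)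

/-- The polynomials `λ^{n-i}` and the heads of `Q` are dual bases for the residue pairing. -/
theorem residue_X_pow_mul_headPoly (x : Fin n → R) (i k : Fin n) :
    residue x (X ^ (n - 1 - (i : ℕ)) * headPoly x k) = if i = k then 1 else 0 := by
  have hi := i.2
  have hk := k.2
  rcases le_or_gt (k : ℕ) i with h | h
  · rw [residue_of_degree_lt x (degree_X_pow_mul_lt (degree_headPoly_lt x k) (by omega)),
      coeff_X_pow_mul', if_pos (by omega), show n - 1 - (n - 1 - (i : ℕ)) = i by omega,
      coeff_headPoly_of_le x h]
    simp only [Fin.ext_iff]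
  · have e : X ^ (n - 1 - (i : ℕ)) * headPoly x k = vietePoly x * X ^ ((k : ℕ) - 1 - i) -
        X ^ ((k : ℕ) - 1 - i) * (vietePoly x - X ^ (n - k) * headPoly x k) := by
      rw [show n - 1 - (i : ℕ) = ((k : ℕ) - 1 - i) + (n - k) by omega, pow_add]
      ring
    have hd := headPoly_tail x k.2.le
    rw [e, map_sub, residue_vietePoly_mul, residue_of_degree_lt x
      (degree_X_pow_mul_lt hd (by omega)), coeff_X_pow_mul',
      if_neg (show ¬ i = k by rw [Fin.ext_iff]; omega)]
    rw [degree_lt_iff_coeff_zero] at hd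
    split_ifs with h'
    · rw [hd _ (by omega), sub_zero]
    · rw [sub_zero]

theorem residue_vecPoly_mul_headPoly (x u : Fin n → R) (k : Fin n) :
    residue x (vecPoly u * headPoly x k) = u k := by
  rw [vecPoly, Finset.sum_mul, map_sum, Finset.sum_eq_single k]
  · rw [mul_assoc, residue_C_mul, residue_X_pow_mul_headPoly, if_pos rfl, mul_one]
  · intro i _ hi
    rw [mul_assoc, residue_C_mul, residue_X_pow_mul_headPoly, if_neg hi, mul_zero]
  · simp

/-- The heads of `Q` read off the coefficients of a polynomial of degree less than `n`. -/
theorem coeff_eq_residue (x : Fin n → R) {f : R[X]} (hf : f.degree < n) (k : Fin n) :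
    f.coeff (n - 1 - (k : ℕ)) = residue x (headPoly x k * f) := by
  conv_rhs => rw [eq_vecPoly hf, mul_comm, residue_vecPoly_mul_headPoly]

theorem residue_X_pow_eq_zero (x : Fin n → R) {e : ℕ} (he : e < n - 1) :
    residue x (X ^ e) = 0 := by
  rw [residue_of_degree_lt x, coeff_X_pow, if_neg (by omega)]
  rw [degree_X_pow]
  exact_mod_cast (by omega : e < n)

/-- The residue pairing is nondegenerate. -/
theorem eq_zero_of_residue (x : Fin n → R) {f : R[X]} (hf : f.degree < n)
    (h : ∀ i : Fin n, residue x (X ^ (n - 1 - (i : ℕ)) * f) = 0) : f = 0 := by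
  by_contra hne
  have hd : f.natDegree < n := (natDegree_lt_iff_degree_lt hne).2 hf
  have h1 := h ⟨f.natDegree, hd⟩
  have hlt : f.degree < (f.natDegree + 1 : ℕ) :=
    degree_le_natDegree.trans_lt (by exact_mod_cast Nat.lt_succ_self _)
  rw [residue_of_degree_lt x (degree_X_pow_mul_lt hlt (by dsimp; omega)),
    coeff_X_pow_mul', if_pos (by omega)] at h1
  dsimp only at h1
  rw [show n - 1 - (n - 1 - f.natDegree) = f.natDegree by omega] at h1
  exact hne (leadingCoeff_eq_zero.1 h1)

end

/-- The polynomial `-∑ p_j A_j(λ)`, whose value at a root `λ_i` of `Q` is the momentum `μ_i`. -/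
def momPoly (x p : Fin n → R) : R[X] := -∑ j : Fin n, C (p j) * headPoly x j

theorem degree_momPoly_lt (x p : Fin n → R) : (momPoly x p).degree < n := by
  rw [momPoly, degree_neg, degree_lt_iff_coeff_zero]
  intro m hm
  rw [finsetSum_coeff]
  refine Finset.sum_eq_zero fun j _ => ?_
  rw [coeff_C_mul, coeff_headPoly_of_le x (by omega), if_neg (by omega), mul_zero]

theorem residue_X_pow_mul_momPoly [Nontrivial R] (x p : Fin n → R) (i : Fin n) :
    residue x (X ^ (n - 1 - (i : ℕ)) * momPoly x p) = -p i := by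
  rw [momPoly, mul_neg, map_neg, Finset.mul_sum, map_sum, Finset.sum_eq_single i]
  · rw [mul_left_comm, residue_C_mul, residue_X_pow_mul_headPoly, if_pos rfl, mul_one]
  · intro j _ hj
    rw [mul_left_comm, residue_C_mul, residue_X_pow_mul_headPoly, if_neg hj.symm, mul_zero]
  · simp

/-- Every polynomial of degree less than `n` is the momentum polynomial of its residues. -/
theorem momPoly_residue [Nontrivial R] (x : Fin n → R) {f : R[X]} (hf : f.degree < n) :
    momPoly x (fun i => -residue x (X ^ (n - 1 - (i : ℕ)) * f)) = f := by
  rw [← sub_eq_zero]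
  refine eq_zero_of_residue x ((degree_sub_le _ _).trans_lt
    (max_lt (degree_momPoly_lt _ _) hf)) fun i => ?_
  rw [mul_sub, map_sub, residue_X_pow_mul_momPoly, neg_neg, sub_self]

/-- The coefficients of the remainder of `μ(λ)² - λ^{2n}` modulo `Q`, which are the
Stäckel Hamiltonians. -/
def stackelHam (x p : Fin n → R) (k : Fin n) : R :=
  residue x (headPoly x k * (momPoly x p ^ 2 - X ^ (2 * n)))

/-- The residue formula for `∂H_k/∂p_i`. -/
def stackelHamDP (x p : Fin n → R) (k i : Fin n) : R :=
  residue x (headPoly x k * -(2 * momPoly x p * headPoly x i))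

/-- The polynomial `∑_{j > i} p_j λ^{j-i-1}`, which is `-∂/∂x_i` of the momentum polynomial. -/
def momTail (p : Fin n → R) (i : Fin n) : R[X] :=
  ∑ j : Fin n, if (i : ℕ) < j then C (p j) * X ^ ((j : ℕ) - 1 - i) else 0

/-- The residue formula for `∂H_k/∂x_i`. -/
def stackelHamDX (x p : Fin n → R) (k i : Fin n) : R :=
  residue x (headPoly x k * (-(2 * momPoly x p * momTail p i) -
    (momPoly x p ^ 2 - X ^ (2 * n)) /ₘ vietePoly x * X ^ (n - 1 - (i : ℕ))))

section Naturality

variable {S : Type*} [CommRing S] (φ : R →+* S)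

theorem map_headPoly (x : Fin n → R) (k : ℕ) :
    (headPoly x k).map φ = headPoly (fun i => φ (x i)) k := by
  simp only [headPoly, Polynomial.map_add, Polynomial.map_pow, map_X, Polynomial.map_sum]
  congr 1
  refine Finset.sum_congr rfl fun i _ => ?_
  split_ifs <;> simp

theorem map_residue (x : Fin n → R) (f : R[X]) :
    φ (residue x f) = residue (fun i => φ (x i)) (f.map φ) := by
  rw [residue_apply, residue_apply, ← coeff_map, map_modByMonic _ (monic_vietePoly x), vietePoly,
    map_headPoly]
  rfl

theorem map_momPoly (x p : Fin n → R) :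
    (momPoly x p).map φ = momPoly (fun i => φ (x i)) fun i => φ (p i) := by
  simp [momPoly, Polynomial.map_sum, map_headPoly]

theorem map_momTail (p : Fin n → R) (i : Fin n) :
    (momTail p i).map φ = momTail (fun i => φ (p i)) i := by
  simp only [momTail, Polynomial.map_sum]
  refine Finset.sum_congr rfl fun i _ => ?_
  split_ifs <;> simp

theorem map_stackelHam (x p : Fin n → R) (k : Fin n) :
    φ (stackelHam x p k) = stackelHam (fun i => φ (x i)) (fun i => φ (p i)) k := by
  simp [stackelHam, map_residue, map_headPoly, map_momPoly]

theorem map_stackelHamDP (x p : Fin n → R) (k i : Fin n) :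
    φ (stackelHamDP x p k i) = stackelHamDP (fun i => φ (x i)) (fun i => φ (p i)) k i := by
  simp [stackelHamDP, map_residue, map_headPoly, map_momPoly]

theorem map_stackelHamDX (x p : Fin n → R) (k i : Fin n) :
    φ (stackelHamDX x p k i) = stackelHamDX (fun i => φ (x i)) (fun i => φ (p i)) k i := by
  simp only [stackelHamDX, map_residue, map_headPoly, map_momPoly, map_momTail,
    map_divByMonic φ (monic_vietePoly x), Polynomial.map_mul, Polynomial.map_sub,
    Polynomial.map_neg, Polynomial.map_pow, map_X, Polynomial.map_ofNat]
  simp only [vietePoly, map_headPoly]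

end Naturality

/-! ### Derivatives of the Stäckel Hamiltonians -/

variable [Algebra ℝ R]

/-- The linear map underlying `polyD`. -/
def polyDₗ (δ : Derivation ℝ R R) : R[X] →ₗ[ℝ] R[X] where
  toFun f := ∑ i ∈ f.support, monomial i (δ (f.coeff i))
  map_add' f g := by
    ext m
    simp only [finsetSum_coeff, coeff_monomial, Finset.sum_ite_eq', coeff_add, mem_support_iff]
    split_ifs <;> simp_all [← map_add]
  map_smul' t f := by
    ext m
    simp only [finsetSum_coeff, coeff_monomial, Finset.sum_ite_eq', coeff_smul,
      mem_support_iff, RingHom.id_apply]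
    split_ifs <;> simp_all

theorem coeff_polyDₗ (δ : Derivation ℝ R R) (f : R[X]) (m : ℕ) :
    (polyDₗ δ f).coeff m = δ (f.coeff m) := by
  change (∑ i ∈ f.support, monomial i (δ (f.coeff i))).coeff m = _
  simp only [finsetSum_coeff, coeff_monomial, Finset.sum_ite_eq', mem_support_iff]
  split_ifs <;> simp_all

/-- The extension of a derivation `δ` of `R` to `R[λ]` that acts on coefficients. -/
def polyD (δ : Derivation ℝ R R) : Derivation ℝ R[X] R[X] :=
  Derivation.mk' (polyDₗ δ) fun f g => by
    ext m
    simp only [smul_eq_mul, coeff_add, coeff_polyDₗ, coeff_mul, map_sum, Derivation.leibniz,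
      Finset.sum_add_distrib]
    congr 1
    rw [← Finset.Nat.sum_antidiagonal_swap]
    rfl

theorem coeff_polyD (δ : Derivation ℝ R R) (f : R[X]) (m : ℕ) :
    (polyD δ f).coeff m = δ (f.coeff m) := coeff_polyDₗ δ f m

theorem polyD_C_mul_X_pow (δ : Derivation ℝ R R) (t : R) (m : ℕ) :
    polyD δ (C t * X ^ m) = C (δ t) * X ^ m := by
  ext i
  rw [coeff_polyD, coeff_C_mul, coeff_C_mul, coeff_X_pow]
  split_ifs <;> simp

theorem polyD_X_pow (δ : Derivation ℝ R R) (m : ℕ) : polyD δ (X ^ m) = 0 := by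
  simpa using polyD_C_mul_X_pow δ 1 m

theorem polyD_C (δ : Derivation ℝ R R) (t : R) : polyD δ (C t) = C (δ t) := by
  simpa using polyD_C_mul_X_pow δ t 0

theorem degree_polyD_lt {δ : Derivation ℝ R R} {f : R[X]} {m : ℕ} (hf : f.degree < m) :
    (polyD δ f).degree < (m : WithBot ℕ) := by
  rw [degree_lt_iff_coeff_zero] at hf ⊢
  intro l hl
  rw [coeff_polyD, hf l hl, map_zero]

theorem polyD_headPoly (δ : Derivation ℝ R R) (x : Fin n → R) (k : ℕ) :
    polyD δ (headPoly x k) =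
      ∑ i : Fin n, if (i : ℕ) < k then C (δ (x i)) * X ^ (k - 1 - (i : ℕ)) else 0 := by
  rw [headPoly, map_add, polyD_X_pow, zero_add, map_sum]
  refine Finset.sum_congr rfl fun i _ => ?_
  split_ifs
  · rw [polyD_C_mul_X_pow]
  · rw [map_zero]

theorem polyD_vietePoly (δ : Derivation ℝ R R) (x : Fin n → R) :
    polyD δ (vietePoly x) = vecPoly fun i => δ (x i) := by
  rw [vietePoly, polyD_headPoly, vecPoly]
  exact Finset.sum_congr rfl fun i _ => if_pos i.2

/-- The momentum polynomial depends on the positions through the heads of `Q`. -/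
theorem polyD_momPoly (δ : Derivation ℝ R R) (x p : Fin n → R) :
    polyD δ (momPoly x p) = momPoly x (fun i => δ (p i)) -
      ∑ j : Fin n, C (p j) * polyD δ (headPoly x j) := by
  simp only [momPoly, map_neg, map_sum, Derivation.leibniz, smul_eq_mul, polyD_C,
    Finset.sum_add_distrib]
  rw [neg_add', sub_eq_add_neg, sub_eq_add_neg, add_comm]
  congr 2
  exact Finset.sum_congr rfl fun _ _ => mul_comm _ _

variable [Nontrivial R]

/-- Differentiating `μ² - λ^{2n} = S Q + ∑ H_k λ^{n-k}` and reducing modulo `Q`. -/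
theorem derivation_stackelHam (δ : Derivation ℝ R R) (x p : Fin n → R) (k : Fin n) :
    δ (stackelHam x p k) = residue x (headPoly x k * (2 * momPoly x p * polyD δ (momPoly x p) -
      (momPoly x p ^ 2 - X ^ (2 * n)) /ₘ vietePoly x * polyD δ (vietePoly x))) := by
  set F := momPoly x p ^ 2 - X ^ (2 * n) with hF
  have h1 : polyD δ F = 2 * momPoly x p * polyD δ (momPoly x p) := by
    rw [hF, map_sub, polyD_X_pow, pow_two, Derivation.leibniz, smul_eq_mul]
    ring
  have h2 := congrArg (polyD δ) (modByMonic_add_div F (vietePoly x))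
  rw [map_add, Derivation.leibniz, smul_eq_mul, smul_eq_mul, h1] at h2
  have hd := degree_mod_lt x F
  rw [stackelHam, ← hF, ← residue_mul_mod, ← coeff_eq_residue x hd, ← coeff_polyD,
    coeff_eq_residue x (degree_polyD_lt hd), ← h2]
  have e : headPoly x k * (polyD δ (F %ₘ vietePoly x) + (vietePoly x * polyD δ (F /ₘ vietePoly x) +
      F /ₘ vietePoly x * polyD δ (vietePoly x)) - F /ₘ vietePoly x * polyD δ (vietePoly x)) =
      headPoly x k * polyD δ (F %ₘ vietePoly x) +
      vietePoly x * (headPoly x k * polyD δ (F /ₘ vietePoly x)) := by ring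
  rw [e, map_add, residue_vietePoly_mul, add_zero]

theorem derivation_stackelHam_momentum {δ : Derivation ℝ R R} {x p : Fin n → R} {i : Fin n}
    (hx : ∀ j, δ (x j) = 0) (hp : ∀ j, δ (p j) = if j = i then 1 else 0) (k : Fin n) :
    δ (stackelHam x p k) = stackelHamDP x p k i := by
  rw [derivation_stackelHam, polyD_vietePoly, polyD_momPoly, stackelHamDP]
  simp only [polyD_headPoly, hx, hp, vecPoly, momPoly]
  simp

theorem derivation_stackelHam_position {δ : Derivation ℝ R R} {x p : Fin n → R} {i : Fin n}
    (hx : ∀ j, δ (x j) = if j = i then 1 else 0) (hp : ∀ j, δ (p j) = 0) (k : Fin n) :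
    δ (stackelHam x p k) = stackelHamDX x p k i := by
  have h1 : polyD δ (momPoly x p) = -momTail p i := by
    have h0 : ∀ m : ℕ, polyD δ (headPoly x m) =
        if (i : ℕ) < m then X ^ (m - 1 - (i : ℕ)) else 0 := by
      intro m
      rw [polyD_headPoly, Finset.sum_eq_single i]
      · simp [hx]
      · intro j _ hj
        simp [hx, hj]
      · simp
    rw [polyD_momPoly]
    simp [h0, hp, momPoly, momTail]
  have h2 : polyD δ (vietePoly x) = X ^ (n - 1 - (i : ℕ)) := by
    rw [polyD_vietePoly, vecPoly, Finset.sum_eq_single i]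
    · simp [hx]
    · intro j _ hj
      simp [hx, hj]
    · simp
  rw [derivation_stackelHam, h1, h2, stackelHamDX, mul_neg]

/-! ### From the Lax equation to Hamilton's equations -/

/-- The products of `λ^{n-i}` with `δ A_j(λ)` and of `λ^{j-i-1}` with `δ Q` (or `0` unless `i < j`)
differ by terms of degree less than `n - 1`, which have residue `0`. -/
theorem residue_polyD_headPoly (δ : Derivation ℝ R R) (x : Fin n → R) (i j : Fin n) :
    residue x (X ^ (n - 1 - (i : ℕ)) * polyD δ (headPoly x j)) =
      residue x (if (i : ℕ) < j then polyD δ (vietePoly x) * X ^ ((j : ℕ) - 1 - i) else 0) := by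
  have hi := i.2
  have hj := j.2
  rw [polyD_headPoly, polyD_vietePoly, vecPoly, Finset.mul_sum, map_sum]
  split_ifs with hij
  · rw [Finset.sum_mul, map_sum]
    refine Finset.sum_congr rfl fun m _ => ?_
    have hm := m.2
    rw [mul_assoc, residue_C_mul, ← pow_add]
    split_ifs with h
    · rw [mul_left_comm, residue_C_mul, ← pow_add]
      congr 3
      omega
    · rw [mul_zero, map_zero, residue_X_pow_eq_zero x (by omega), mul_zero]
  · rw [map_zero]
    refine Finset.sum_eq_zero fun m _ => ?_
    split_ifs with h
    · rw [mul_left_comm, residue_C_mul, ← pow_add, residue_X_pow_eq_zero x (by omega), mul_zero]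
    · rw [mul_zero, map_zero]

/-- The Lax equation, written for the entries `Q`, `N = μ(λ)` and `T` of a Lax matrix
`(N, Q; T, -N)`, is Hamilton's system for `H_k`. -/
theorem hamilton_of_lax {δ : Derivation ℝ R R} {x p : Fin n → R} {T vN vT H : R[X]} {k : Fin n}
    (hH : H.degree < n) (hdet : momPoly x p ^ 2 - X ^ (2 * n) = H - vietePoly x * T)
    (hQ : polyD δ (vietePoly x) = 2 * (vietePoly x * vN - momPoly x p * headPoly x k))
    (hN : polyD δ (momPoly x p) = T * headPoly x k - vietePoly x * vT) (i : Fin n) :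
    δ (x i) = stackelHamDP x p k i ∧ δ (p i) = -stackelHamDX x p k i := by
  have hS : (momPoly x p ^ 2 - X ^ (2 * n)) /ₘ vietePoly x = -T :=
    (div_modByMonic_unique (-T) H (monic_vietePoly x)
      ⟨by rw [hdet]; ring, by rwa [degree_vietePoly]⟩).1
  constructor
  · have h := residue_vecPoly_mul_headPoly x (fun i => δ (x i)) i
    rw [← h, ← polyD_vietePoly, hQ, stackelHamDP]
    have e : 2 * (vietePoly x * vN - momPoly x p * headPoly x k) * headPoly x i =
        vietePoly x * (2 * vN * headPoly x i) +
        headPoly x k * -(2 * momPoly x p * headPoly x i) := by ring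
    rw [e, map_add, residue_vietePoly_mul, zero_add]
  · -- pairing the derivative of `μ(λ) = -∑ p_j A_j(λ)` with `λ^{n-i}` isolates `δ (p i)`
    have h := polyD_momPoly δ x p
    have h1 := congrArg (fun f => residue x (X ^ (n - 1 - (i : ℕ)) * f)) h
    simp only [mul_sub, map_sub, residue_X_pow_mul_momPoly, Finset.mul_sum, map_sum] at h1
    have h2 : ∀ j : Fin n, residue x (X ^ (n - 1 - (i : ℕ)) * (C (p j) * polyD δ (headPoly x j))) =
        residue x (polyD δ (vietePoly x) *
          if (i : ℕ) < j then C (p j) * X ^ ((j : ℕ) - 1 - i) else 0) := by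
      intro j
      rw [mul_left_comm, residue_C_mul, residue_polyD_headPoly]
      split_ifs
      · rw [mul_left_comm (polyD δ _), residue_C_mul]
      · simp
    simp only [h2] at h1
    rw [← map_sum, ← Finset.mul_sum, ← momTail, hQ, hN] at h1
    have e1 : X ^ (n - 1 - (i : ℕ)) * (T * headPoly x k - vietePoly x * vT) =
        headPoly x k * (T * X ^ (n - 1 - (i : ℕ))) -
        vietePoly x * (X ^ (n - 1 - (i : ℕ)) * vT) := by ring
    have e2 : 2 * (vietePoly x * vN - momPoly x p * headPoly x k) * momTail p i =
        vietePoly x * (2 * vN * momTail p i) +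
        headPoly x k * -(2 * momPoly x p * momTail p i) := by ring
    rw [e1, e2, map_sub, map_add, residue_vietePoly_mul, residue_vietePoly_mul] at h1
    rw [stackelHamDX, hS, neg_mul, sub_neg_eq_add, mul_add, map_add]
    linear_combination h1

end Viete

/-! ### The Stäckel system as residues -/

section Staeckel

open Polynomial Matrix

variable {n : ℕ}

theorem qExt_of_neg (x : Fin n → ℝ) {m : ℤ} (h : m < 0) : qExt x m = 0 := by
  rw [qExt, if_neg (by omega), dif_neg (by omega)]

theorem qExt_of_gt (x : Fin n → ℝ) {m : ℤ} (h : n < m) : qExt x m = 0 := by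
  rw [qExt, if_neg (by omega), dif_neg (by omega)]

theorem coeff_headPoly (x : Fin n → ℝ) {k : ℕ} (hk : k ≤ n) (m : ℕ) :
    (headPoly x k).coeff m = qExt x ((k : ℤ) - m) := by
  rcases le_or_gt k m with h | h
  · rw [coeff_headPoly_of_le x h]
    split_ifs with he
    · rw [he, sub_self, qExt, if_pos rfl]
    · rw [qExt_of_neg x (by omega)]
  · rw [coeff_headPoly_of_lt x h hk, qExt, if_neg (by omega), dif_pos (by omega)]
    congr 1
    ext
    dsimp
    omega

theorem degree_headPoly_lt_card (x : Fin n → ℝ) (k : Fin n) :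
    (headPoly x k).degree < (n : WithBot ℕ) :=
  (degree_headPoly_lt x k).trans_le (by exact_mod_cast k.2)

theorem vecPoly_sum_smul {R ι : Type*} [CommRing R] (s : Finset ι) (t : ι → R)
    (u : ι → Fin n → R) :
    vecPoly (fun i => ∑ j ∈ s, t j * u j i) = ∑ j ∈ s, C (t j) * vecPoly (u j) := by
  simp only [vecPoly, map_sum, map_mul, Finset.sum_mul, Finset.mul_sum]
  rw [Finset.sum_comm]
  simp only [mul_assoc]

theorem vecPoly_mulVec (M : Matrix (Fin n) (Fin n) ℝ) (u : Fin n → ℝ) :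
    vecPoly (M *ᵥ u) = ∑ j, C (u j) * vecPoly fun i => M i j := by
  rw [← vecPoly_sum_smul]
  congr 1
  ext i
  simp [mulVec, dotProduct, mul_comm]

/-- Multiplication by the metric turns momenta into the coefficients of `-2 μ(λ)`. -/
theorem vecPoly_G_mulVec (x p : Fin n → ℝ) : vecPoly (G x *ᵥ p) = -(2 * momPoly x p) := by
  rw [vecPoly_mulVec, momPoly, mul_neg, neg_neg, Finset.mul_sum]
  refine Finset.sum_congr rfl fun j _ => ?_
  rw [mul_left_comm]
  congr 1
  conv_rhs => rw [eq_vecPoly (degree_headPoly_lt_card x j), ← map_ofNat (C (R := ℝ)) 2]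
  rw [vecPoly, vecPoly, Finset.mul_sum]
  refine Finset.sum_congr rfl fun i _ => ?_
  rw [← mul_assoc, ← C_mul, coeff_headPoly x j.2.le, G, of_apply]
  congr 4
  have := i.2
  omega

theorem eq_of_momPoly_eq {x p p' : Fin n → ℝ} (h : momPoly x p = momPoly x p') : p = p' := by
  ext i
  have h1 := residue_X_pow_mul_momPoly x p i
  rw [h, residue_X_pow_mul_momPoly] at h1
  exact (neg_injective h1).symm

/-- `G` is injective because a momentum polynomial determines its momenta. -/
theorem isUnit_det_G (x : Fin n → ℝ) : IsUnit (G x).det := by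
  rw [← Matrix.isUnit_iff_isUnit_det, ← Matrix.mulVec_injective_iff_isUnit]
  intro p p' h
  have h1 : momPoly x p = momPoly x p' := by
    have := congrArg vecPoly h
    simp only [vecPoly_G_mulVec] at this
    exact mul_left_cancel₀ (two_ne_zero) (neg_injective this)
  exact eq_of_momPoly_eq h1

/-- The Killing tensor `A_k` acts on coefficient vectors as multiplication by the head `A_k(λ)`
modulo `Q`. -/
theorem vecPoly_killing (x : Fin n → ℝ) (k j : Fin n) :
    vecPoly (fun i => killing k x i j) = headPoly x k * X ^ (n - 1 - (j : ℕ)) -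
      vietePoly x * if j < k then X ^ ((k : ℕ) - 1 - j) else 0 := by
  have hj := j.2
  have hk := k.2
  ext m
  rw [coeff_vecPoly, coeff_sub, coeff_mul_X_pow', vietePoly]
  by_cases hm : m < n
  · rw [dif_pos hm, killing, of_apply]
    have e1 : ((⟨n - 1 - m, by omega⟩ : Fin n) : ℤ) = (n : ℤ) - 1 - m := by
      dsimp; omega
    have e2 : n - 1 - (j : ℕ) ≤ m →
        (headPoly x k).coeff (m - (n - 1 - (j : ℕ))) = qExt x ((n : ℤ) - 1 - m - j + k) := by
      intro h
      rw [coeff_headPoly x hk.le]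
      congr 1
      omega
    have e3 : (headPoly x n * X ^ ((k : ℕ) - 1 - j)).coeff m =
        if (j : ℕ) < k then qExt x ((n : ℤ) - 1 - m - j + k) else
          (headPoly x n * X ^ ((k : ℕ) - 1 - j)).coeff m := by
      split_ifs with h
      · rw [coeff_mul_X_pow']
        split_ifs with h'
        · rw [coeff_headPoly x le_rfl]
          congr 1
          omega
        · rw [qExt_of_gt x (by omega)]
      · rfl
    have e4 : ((⟨n - 1 - m, by omega⟩ : Fin n) : ℤ) + 1 - ((j : ℤ) + 1) + ((k : ℤ) + 1) - 1 =
        (n : ℤ) - 1 - m - j + k := by rw [e1]; ring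
    rw [e4]
    simp only [Fin.le_def, Fin.lt_def]
    by_cases h1 : (j : ℕ) < k
    · rw [if_neg (by omega), if_pos h1, e3, if_pos h1]
      by_cases h2 : n - 1 - (j : ℕ) ≤ m
      · rw [if_neg (by omega), if_pos h2, e2 h2, sub_self]
      · rw [if_pos (by omega), if_neg h2, zero_sub]
    · rw [if_neg h1, mul_zero, coeff_zero, sub_zero]
      by_cases h2 : n - 1 - (j : ℕ) ≤ m
      · rw [if_pos (by omega), if_pos h2, e2 h2]
      · rw [if_neg (by omega), if_neg (by omega), if_neg h2]
  · rw [dif_neg hm]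
    by_cases h1 : (j : ℕ) < k
    · rw [if_pos (by omega), if_pos (show j < k from h1), coeff_mul_X_pow', if_pos (by omega),
        coeff_headPoly x hk.le, coeff_headPoly x le_rfl, eq_comm, sub_eq_zero]
      congr 1
      omega
    · rw [if_neg (show ¬ j < k from h1), mul_zero, coeff_zero, sub_zero, if_pos (by omega),
        coeff_headPoly x hk.le, qExt_of_neg x (by omega)]

/-- `vecPoly_killing` in the form in which the term divisible by `Q` has disappeared. -/
theorem residue_killing_mulVec (x u : Fin n → ℝ) (k : Fin n) (f : ℝ[X]) :
    residue x (vecPoly (killing k x *ᵥ u) * f) = residue x (headPoly x k * vecPoly u * f) := by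
  have e : vecPoly (killing k x *ᵥ u) * f = headPoly x k * vecPoly u * f -
      vietePoly x * ((∑ j, C (u j) * if j < k then X ^ ((k : ℕ) - 1 - j) else 0) * f) := by
    rw [vecPoly_mulVec]
    simp only [vecPoly_killing]
    simp only [mul_sub, Finset.sum_sub_distrib, sub_mul, mul_left_comm _ (vietePoly x),
      ← Finset.mul_sum, mul_assoc, mul_left_comm _ (headPoly x k)]
    simp only [vecPoly]
  rw [e, map_sub, residue_vietePoly_mul, sub_zero]

/-- The kinetic energy is the `k`-th coefficient of `μ(λ)²` modulo `Q`. -/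
theorem kinetic_eq_residue (x p : Fin n → ℝ) (k : Fin n) :
    1 / 2 * (p ⬝ᵥ ((killing k x * G x) *ᵥ p)) =
      residue x (headPoly x k * momPoly x p ^ 2) := by
  rw [← mulVec_mulVec]
  have h : ∀ i, (killing k x *ᵥ (G x *ᵥ p)) i =
      residue x (headPoly x k * -(2 * momPoly x p) * headPoly x i) := fun i => by
    rw [← vecPoly_G_mulVec, ← residue_killing_mulVec, residue_vecPoly_mul_headPoly]
  have e : headPoly x k * momPoly x p ^ 2 =
      ∑ i, C (1 / 2 * p i) * (headPoly x k * -(2 * momPoly x p) * headPoly x i) := by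
    have h2 : (2 : ℝ[X]) * C (1 / 2) = 1 := by
      rw [← map_ofNat (C (R := ℝ)) 2, ← C_mul]; norm_num
    simp only [C_mul, mul_assoc, mul_left_comm _ (headPoly x k)]
    rw [← Finset.mul_sum]
    congr 1
    simp only [mul_left_comm (C (p _)), ← Finset.mul_sum]
    have h3 : ∑ i : Fin n, C (p i) * headPoly x i = -momPoly x p := by rw [momPoly, neg_neg]
    simp only [neg_mul, mul_neg, mul_assoc]
    rw [h3]
    linear_combination -momPoly x p ^ 2 * h2
  rw [e, map_sum, dotProduct, Finset.mul_sum]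
  refine Finset.sum_congr rfl fun i _ => ?_
  rw [h, residue_C_mul]
  ring

/-- The recursion matrix acts on coefficient vectors as multiplication by `λ` modulo `Q`. -/
theorem vecPoly_potentialMatrix_mulVec (x u : Fin n → ℝ) :
    ∃ t : ℝ, vecPoly (potentialMatrix x *ᵥ u) = X * vecPoly u - vietePoly x * C t := by
  rcases Nat.eq_zero_or_pos n with hn | hn
  · subst hn
    exact ⟨0, by simp [vecPoly]⟩
  · have h : ∀ i : Fin n, (potentialMatrix x *ᵥ u) i = -x i * u ⟨0, hn⟩ +
        if h : (i : ℕ) + 1 < n then u ⟨i + 1, h⟩ else 0 := by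
      intro i
      simp only [mulVec, dotProduct, potentialMatrix, of_apply, add_mul, Finset.sum_add_distrib]
      congr 1
      · rw [Finset.sum_eq_single ⟨0, hn⟩]
        · simp
        · intro j _ hj
          rw [if_neg (fun h => hj (Fin.ext h)), zero_mul]
        · simp
      · split_ifs with hi
        · rw [Finset.sum_eq_single ⟨i + 1, hi⟩]
          · simp
          · intro j _ hj
            rw [if_neg (fun h => hj (Fin.ext h)), zero_mul]
          · simp
        · refine Finset.sum_eq_zero fun j _ => ?_
          rw [if_neg (by omega), zero_mul]
    refine ⟨u ⟨0, hn⟩, ?_⟩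
    ext m
    rw [coeff_vecPoly, coeff_sub, coeff_mul_C, vietePoly_eq, coeff_add, coeff_X_pow,
      coeff_vecPoly]
    by_cases hm : m < n
    · rw [dif_pos hm, dif_pos hm, h, if_neg (by omega)]
      rcases m with _ | m
      · rw [coeff_X_mul_zero, dif_neg (by dsimp; omega)]
        ring
      · rw [coeff_X_mul, coeff_vecPoly, dif_pos (by dsimp; omega), dif_pos (by omega)]
        have : (⟨n - 1 - (m + 1) + 1, by omega⟩ : Fin n) = ⟨n - 1 - m, by omega⟩ :=
          Fin.ext (by dsimp; omega)
        rw [this]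
        ring
    · rw [dif_neg hm, dif_neg hm]
      obtain ⟨m, rfl⟩ := Nat.exists_eq_add_of_le' (show 1 ≤ m by omega)
      rw [coeff_X_mul, coeff_vecPoly]
      split_ifs with h1 h2
      · have : (⟨n - 1 - m, by omega⟩ : Fin n) = ⟨0, hn⟩ := Fin.ext (by dsimp; omega)
        rw [this]
        ring
      · omega
      · omega
      · ring

/-- The coefficient vector of `V^{(α)}` is `-λ^α` modulo `Q`. -/
theorem vecPoly_potential (x : Fin n → ℝ) (α : ℕ) :
    ∃ f : ℝ[X], vecPoly (potential α x) = -X ^ α + vietePoly x * f := by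
  induction α with
  | zero =>
    rcases Nat.eq_zero_or_pos n with hn | hn
    · subst hn
      exact ⟨1, by simp [vecPoly, vietePoly, headPoly]⟩
    · refine ⟨0, ?_⟩
      rw [potential, pow_zero, one_mulVec, vecPoly, Finset.sum_eq_single ⟨n - 1, by omega⟩]
      · rw [if_pos (by dsimp; omega), show n - 1 - (n - 1) = 0 by omega]
        simp
      · intro j _ hj
        rw [if_neg (fun h => hj (Fin.ext (by dsimp; omega))), C_0, zero_mul]
      · simp
  | succ α ih =>
    obtain ⟨f, hf⟩ := ih
    obtain ⟨t, ht⟩ := vecPoly_potentialMatrix_mulVec x (potential α x)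
    refine ⟨X * f - C t, ?_⟩
    have : potential (α + 1) x = potentialMatrix x *ᵥ potential α x := by
      rw [potential, potential, mulVec_mulVec, pow_succ']
    rw [this, ht, hf]
    ring

/-- The Hamiltonians `H_k` are the coefficients of the remainder of `μ(λ)² - λ^{2n}`
modulo `Q`. -/
theorem hamiltonian_eq (k : Fin n) (w : Phase n) :
    hamiltonian k w = stackelHam w.1 w.2 k := by
  obtain ⟨f, hf⟩ := vecPoly_potential w.1 (2 * n)
  have h := residue_vecPoly_mul_headPoly w.1 (potential (2 * n) w.1) k
  have e : (-X ^ (2 * n) + vietePoly w.1 * f) * headPoly w.1 k =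
      vietePoly w.1 * (f * headPoly w.1 k) - headPoly w.1 k * X ^ (2 * n) := by ring
  rw [hf, e, map_sub, residue_vietePoly_mul, zero_sub] at h
  rw [hamiltonian, kinetic_eq_residue, ← h, stackelHam, mul_sub, map_sub, sub_eq_add_neg]

/-- The polynomial `∑ H_k λ^{n-k}` of the separation curve. -/
theorem vecPoly_hamiltonian (w : Phase n) : (vecPoly fun k => hamiltonian k w) =
    (momPoly w.1 w.2 ^ 2 - X ^ (2 * n)) %ₘ vietePoly w.1 := by
  rw [eq_vecPoly (degree_mod_lt w.1 _)]
  congr 1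
  ext k
  rw [hamiltonian_eq, coeff_eq_residue w.1 (degree_mod_lt w.1 _), residue_mul_mod, stackelHam]

end Staeckel

/-! ### Separation coordinates -/

section Separation

open Polynomial

variable {n : ℕ}

/-- The polynomial `Q` has the separation coordinates `λ_j` as its roots. -/
theorem vietePoly_viete (ξ : Phase n) : vietePoly (viete ξ).1 = ∏ j, (X - C (ξ.1 j)) := by
  have hp : ∏ j, (X - C (ξ.1 j)) = ((Finset.univ.val.map ξ.1).map fun t => X - C t).prod := by
    rw [Multiset.map_map]; rfl
  have hcard : Multiset.card (Finset.univ.val.map ξ.1) = n := by simp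
  have hmon : (∏ j, (X - C (ξ.1 j))).Monic := monic_prod_X_sub_C _ _
  have hdeg : (∏ j, (X - C (ξ.1 j))).natDegree = n := by simp
  ext m
  rw [vietePoly_eq, coeff_add, coeff_X_pow, coeff_vecPoly]
  rcases lt_trichotomy m n with h | h | h
  · rw [if_neg (by omega), dif_pos h, zero_add, hp, Multiset.prod_X_sub_C_coeff _ (by omega), hcard]
    simp only [viete, ← MvPolynomial.aeval_esymm_eq_multiset_esymm (Fin n) ℝ,
      MvPolynomial.aeval_eq_eval]
    rw [show n - 1 - m + 1 = n - m by omega]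
  · rw [if_pos h, dif_neg (by omega), add_zero]
    have := hmon.coeff_natDegree
    rw [hdeg] at this
    exact this.symm.trans (congrArg _ h.symm)
  · rw [if_neg (by omega), dif_neg (by omega), add_zero,
      coeff_eq_zero_of_natDegree_lt (by omega)]

theorem eval_vietePoly_viete (ξ : Phase n) (k : Fin n) :
    (vietePoly (viete ξ).1).eval (ξ.1 k) = 0 := by
  rw [vietePoly_viete, eval_prod, Finset.prod_eq_zero (Finset.mem_univ k)]
  simp

/-- At distinct roots the residue functional is the sum of the residues at the roots. -/
theorem residue_eq_sum {ξ : Phase n} (hξ : Function.Injective ξ.1) (f : ℝ[X]) :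
    residue (viete ξ).1 f =
      ∑ k, f.eval (ξ.1 k) / ∏ j ∈ Finset.univ.erase k, (ξ.1 k - ξ.1 j) := by
  have h := Lagrange.coeff_eq_sum (s := Finset.univ) (v := ξ.1) hξ.injOn
    (P := f %ₘ vietePoly (viete ξ).1) (by simpa using degree_mod_lt (viete ξ).1 f)
  rw [Finset.card_univ, Fintype.card_fin] at h
  rw [residue_apply, h]
  refine Finset.sum_congr rfl fun k _ => ?_
  conv_rhs => rw [← modByMonic_add_div f (vietePoly (viete ξ).1), eval_add, eval_mul,
    eval_vietePoly_viete, zero_mul, add_zero]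

/-- The momentum polynomial interpolates the separation momenta: `μ(λ_k) = μ_k`. -/
theorem eval_momPoly_viete {ξ : Phase n} (hξ : Function.Injective ξ.1) (k : Fin n) :
    (momPoly (viete ξ).1 (viete ξ).2).eval (ξ.1 k) = ξ.2 k := by
  set f := Lagrange.interpolate Finset.univ ξ.1 ξ.2 with hf
  have hd : f.degree < n := by
    have := Lagrange.degree_interpolate_lt (s := Finset.univ) ξ.2 hξ.injOn
    rwa [Finset.card_univ, Fintype.card_fin] at this
  have he : ∀ k, f.eval (ξ.1 k) = ξ.2 k := fun k =>
    Lagrange.eval_interpolate_at_node ξ.2 hξ.injOn (Finset.mem_univ k)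
  have hp : (viete ξ).2 = fun i : Fin n =>
      -residue (viete ξ).1 (X ^ (n - 1 - (i : ℕ)) * f) := by
    ext i
    rw [residue_eq_sum hξ]
    simp only [viete, eval_mul, eval_pow, eval_X, he, Nat.sub_sub, add_comm 1]
  rw [hp, momPoly_residue _ hd, he]

/-- Evaluating `μ(λ)² - λ^{2n} = S Q + ∑ H_k λ^{n-k}` at a root of `Q`. -/
theorem separation_relation {ξ : Phase n} (hξ : Function.Injective ξ.1) (i : Fin n) :
    ξ.1 i ^ (2 * n) + ∑ k : Fin n, hamiltonian k (viete ξ) * ξ.1 i ^ (n - ((k : ℕ) + 1)) =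
      ξ.2 i ^ 2 := by
  have h := congrArg (eval (ξ.1 i)) (modByMonic_add_div
    (momPoly (viete ξ).1 (viete ξ).2 ^ 2 - X ^ (2 * n)) (vietePoly (viete ξ).1))
  rw [← vecPoly_hamiltonian, eval_add, eval_mul, eval_vietePoly_viete, zero_mul, add_zero, eval_sub,
    eval_pow, eval_pow, eval_X, eval_momPoly_viete hξ, vecPoly, eval_finsetSum] at h
  simp only [eval_mul, eval_C, eval_pow, eval_X, Nat.sub_sub, add_comm 1] at h
  rw [h]
  ring

theorem prod_sub_ne_zero {ξ : Phase n} (hξ : Function.Injective ξ.1) (k : Fin n) :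
    ∏ j ∈ Finset.univ.erase k, (ξ.1 k - ξ.1 j) ≠ 0 :=
  Finset.prod_ne_zero_iff.2 fun _ hj =>
    sub_ne_zero.2 fun h => Finset.ne_of_mem_erase hj (hξ h).symm

theorem hasFDerivAt_coord (ξ : Phase n) (j : Fin n) :
    HasFDerivAt (fun ξ' : Phase n => ξ'.1 j)
      ((ContinuousLinearMap.proj (R := ℝ) (φ := fun _ : Fin n => ℝ) j).comp
        (ContinuousLinearMap.fst ℝ (Fin n → ℝ) (Fin n → ℝ))) ξ :=
  ((ContinuousLinearMap.proj (R := ℝ) (φ := fun _ : Fin n => ℝ) j).comp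
    (ContinuousLinearMap.fst ℝ (Fin n → ℝ) (Fin n → ℝ))).hasFDerivAt

theorem differentiableAt_viete {ξ : Phase n} (hξ : Function.Injective ξ.1) :
    DifferentiableAt ℝ viete ξ := by
  unfold viete
  have h1 : ∀ j : Fin n, DifferentiableAt ℝ (fun ξ' : Phase n => ξ'.1 j) ξ := fun j =>
    (hasFDerivAt_coord ξ j).differentiableAt
  have h2 : ∀ j : Fin n, DifferentiableAt ℝ (fun ξ' : Phase n => ξ'.2 j) ξ := fun j => by fun_prop
  refine DifferentiableAt.prodMk (differentiableAt_pi.2 fun i => ?_)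
    (differentiableAt_pi.2 fun i => ?_)
  · exact DifferentiableAt.const_mul (DifferentiableAt.comp (𝕜 := ℝ)
      (g := fun y => MvPolynomial.eval y (MvPolynomial.esymm (Fin n) ℝ ((i : ℕ) + 1))) ξ
      (differentiableAt_eval _ _) differentiableAt_fst) _
  · refine DifferentiableAt.fun_neg (DifferentiableAt.fun_sum fun k _ => ?_)
    have h3 : DifferentiableAt ℝ
        (fun ξ' : Phase n => ∏ j ∈ Finset.univ.erase k, (ξ'.1 k - ξ'.1 j)) ξ :=
      (HasFDerivAt.finsetProd fun j _ => ((h1 k).fun_sub (h1 j)).hasFDerivAt).differentiableAt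
    simp only [div_eq_mul_inv]
    exact (((h1 k).fun_pow _).fun_mul (h2 k)).fun_mul (h3.fun_inv (prod_sub_ne_zero hξ k))

/-- The variation `dQ(λ_k) = -dλ_k ∏_{j ≠ k} (λ_k - λ_j)` of `Q = ∏ (λ - λ_j)` at a root. -/
theorem eval_vecPoly_fderiv_viete {ξ : Phase n} (hξ : Function.Injective ξ.1) (η : Phase n)
    (k : Fin n) : (vecPoly (fderiv ℝ viete ξ η).1).eval (ξ.1 k) =
      -(η.1 k * ∏ j ∈ Finset.univ.erase k, (ξ.1 k - ξ.1 j)) := by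
  set t := ξ.1 k with ht
  have hv := (differentiableAt_viete hξ).hasFDerivAt
  have hi : ∀ i : Fin n, HasFDerivAt (fun ξ' : Phase n => (viete ξ').1 i)
      (((ContinuousLinearMap.proj (R := ℝ) (φ := fun _ : Fin n => ℝ) i).comp
        (ContinuousLinearMap.fst ℝ (Fin n → ℝ) (Fin n → ℝ))).comp (fderiv ℝ viete ξ)) ξ :=
    fun i => (hasFDerivAt_coord (viete ξ) i).comp ξ hv
  have h1 : HasFDerivAt
      (fun ξ' : Phase n => t ^ n + ∑ i : Fin n, (viete ξ').1 i * t ^ (n - 1 - (i : ℕ))) _ ξ :=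
    (HasFDerivAt.fun_sum fun (i : Fin n) _ => (hi i).mul_const (t ^ (n - 1 - (i : ℕ)))).const_add
      (t ^ n)
  have h2 := HasFDerivAt.finsetProd (u := Finset.univ) (x := ξ)
    fun (j : Fin n) _ => (hasFDerivAt_coord ξ j).const_sub t
  have e : (fun ξ' : Phase n => t ^ n + ∑ i : Fin n, (viete ξ').1 i * t ^ (n - 1 - (i : ℕ))) =
      fun ξ' : Phase n => ∏ j, (t - ξ'.1 j) := by
    ext ξ'
    have := congrArg (eval t) (vietePoly_viete ξ')
    rw [vietePoly_eq, eval_add, eval_pow, eval_X, vecPoly, eval_finsetSum, eval_prod] at this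
    simpa using this
  rw [e] at h1
  have h3 := congrArg (fun L => L η) (h1.unique h2)
  simp only [sum_apply, smul_apply, smul_eq_mul,
    neg_apply, ContinuousLinearMap.comp_apply, ContinuousLinearMap.proj_apply,
    ContinuousLinearMap.coe_fst'] at h3
  rw [vecPoly, eval_finsetSum]
  simp only [eval_mul, eval_C, eval_pow, eval_X]
  rw [Finset.sum_eq_single (M := ℝ) (a := k) (s := Finset.univ)
    (f := fun j : Fin n => (∏ l ∈ Finset.univ.erase j, (t - ξ.1 l)) * -η.1 j)] at h3
  · rw [mul_comm (η.1 k), ← mul_neg, ← h3]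
    exact Finset.sum_congr rfl fun _ _ => mul_comm _ _
  · intro j _ hj
    rw [Finset.prod_eq_zero (Finset.mem_erase.2 ⟨hj.symm, Finset.mem_univ k⟩)
      (by rw [ht, sub_self]), zero_mul]
  · simp

/-- The Viète transformation is canonical. -/
theorem canonical_viete {ξ : Phase n} (hξ : Function.Injective ξ.1) (η : Phase n) :
    ∑ i : Fin n, (viete ξ).2 i * (fderiv ℝ viete ξ η).1 i = ∑ i : Fin n, ξ.2 i * η.1 i := by
  set v := (fderiv ℝ viete ξ η).1 with hv
  have h : ∀ k : Fin n, ξ.2 k * η.1 k = -(ξ.2 k / (∏ j ∈ Finset.univ.erase k, (ξ.1 k - ξ.1 j)) *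
      (vecPoly v).eval (ξ.1 k)) := by
    intro k
    rw [hv, eval_vecPoly_fderiv_viete hξ]
    have := prod_sub_ne_zero hξ k
    field_simp
  simp only [h, viete, vecPoly, eval_finsetSum, eval_mul, eval_C, eval_pow, eval_X, neg_mul,
    Finset.sum_mul, Finset.mul_sum, ← Finset.sum_neg_distrib, Nat.sub_sub, add_comm 1]
  rw [Finset.sum_comm]
  refine Finset.sum_congr rfl fun k _ => Finset.sum_congr rfl fun i _ => ?_
  ring

end Separation

/-! ### The Lax matrix in Viète form -/

section Reverse

open Polynomial

variable {R : Type*} [CommRing R]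

/-- The polynomial `∑_{i ≤ m} f_i λ^{m-i}` in `λ = z⁻¹` obtained from a power series in `z`. -/
def revPoly (m : ℕ) (f : PowerSeries R) : R[X] :=
  ∑ i ∈ Finset.range (m + 1), C (PowerSeries.coeff i f) * X ^ (m - i)

theorem coeff_revPoly (m : ℕ) (f : PowerSeries R) (j : ℕ) :
    (revPoly m f).coeff j = if j ≤ m then PowerSeries.coeff (m - j) f else 0 := by
  simp only [revPoly, finsetSum_coeff, coeff_C_mul, coeff_X_pow]
  split_ifs with h
  · rw [Finset.sum_eq_single (m - j), if_pos (by omega), mul_one]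
    · intro i hi hne
      rw [Finset.mem_range] at hi
      rw [if_neg (by omega), mul_zero]
    · intro hi
      rw [Finset.mem_range] at hi
      omega
  · refine Finset.sum_eq_zero fun i _ => ?_
    rw [if_neg (by omega), mul_zero]

theorem revPoly_congr {m : ℕ} {f g : PowerSeries R}
    (h : ∀ i ≤ m, PowerSeries.coeff i f = PowerSeries.coeff i g) : revPoly m f = revPoly m g := by
  refine Finset.sum_congr rfl fun i hi => ?_
  rw [h i (by rw [Finset.mem_range] at hi; omega)]

theorem revPoly_sub (m : ℕ) (f g : PowerSeries R) :
    revPoly m (f - g) = revPoly m f - revPoly m g := by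
  ext j
  simp only [coeff_sub, coeff_revPoly, map_sub]
  split_ifs <;> simp

theorem revPoly_two_mul (m : ℕ) (f : PowerSeries R) : revPoly m (2 * f) = 2 * revPoly m f := by
  ext j
  rw [← map_ofNat (C (R := R)) 2, ← map_ofNat (PowerSeries.C (R := R)) 2, coeff_C_mul,
    coeff_revPoly, coeff_revPoly, PowerSeries.coeff_C_mul, mul_ite, mul_zero]

theorem revPoly_lowPart (m : ℕ) (f : PowerSeries R) : revPoly m (lowPart m f) = revPoly m f :=
  revPoly_congr fun i hi => by rw [coeff_lowPart, if_pos hi]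

theorem revPoly_X_pow_mul (m k : ℕ) (f : PowerSeries R) :
    revPoly (m + k) (PowerSeries.X ^ k * f) = revPoly m f := by
  ext j
  rw [coeff_revPoly, coeff_revPoly, PowerSeries.coeff_X_pow_mul']
  by_cases h : j ≤ m
  · rw [if_pos (by omega), if_pos (by omega), if_pos h, show m + k - j - k = m - j by omega]
  · rw [if_neg h]
    split_ifs
    · omega
    · rfl
    · rfl

theorem revPoly_mul (m l : ℕ) (f g : PowerSeries R) :
    revPoly (m + l) (lowPart m f * lowPart l g) = revPoly m f * revPoly l g := by
  have h : ∀ (m : ℕ) (f : PowerSeries R),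
      revPoly m f = reflect m (PowerSeries.trunc (m + 1) f) := by
    intro m f
    ext j
    rw [coeff_revPoly, coeff_reflect, PowerSeries.coeff_trunc]
    split_ifs with h1 h2 h2
    · rw [revAt_le h1]
    · rw [revAt_le h1] at h2; omega
    · rw [revAt_eq_self_of_lt (by omega)] at h2; omega
    · rfl
  have h' : ∀ (m : ℕ) (f : PowerSeries R),
      (PowerSeries.trunc (m + 1) f : PowerSeries R) = lowPart m f := by
    intro m f
    ext j
    rw [coeff_coe, PowerSeries.coeff_trunc, coeff_lowPart]
    simp only [Nat.lt_succ_iff]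
  have hm := Nat.lt_succ_iff.1 (PowerSeries.natDegree_trunc_lt f m)
  have hl := Nat.lt_succ_iff.1 (PowerSeries.natDegree_trunc_lt g l)
  rw [h, h, h, ← h', ← h', ← reflect_mul _ _ hm hl, ← coe_mul, PowerSeries.trunc_coe_eq_self]
  exact Nat.lt_succ_iff.2 (natDegree_mul_le.trans (add_le_add hm hl))

theorem polyD_revPoly [Algebra ℝ R] (δ : Derivation ℝ R R) (m : ℕ) (f : PowerSeries R) :
    polyD δ (revPoly m f) = revPoly m (coeffD δ f) := by
  ext j
  rw [coeff_polyD, coeff_revPoly, coeff_revPoly, coeff_coeffD]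
  split_ifs <;> simp

theorem map_revPoly {S : Type*} [CommRing S] (φ : R →+* S) (m : ℕ) (f : PowerSeries R) :
    (revPoly m f).map φ = revPoly m (f.map φ) := by
  simp [revPoly, Polynomial.map_sum]

end Reverse

section VieteForm

open Polynomial

variable (n : ℕ)

/-- The position coordinates on the stationary manifold. -/
def posPoly (i : Fin n) : LowPoly n :=
  restr n (-MvPolynomial.C (1 / 4) * (2 * a (i + 1) + b (i + 1) + c (i + 1)))

/-- The constant `1/4`. -/
def quarter : (LowPoly n)[X] := C (MvPolynomial.C (1 / 4))

/-- The entry `N = -(b - c) / 4` of the Lax matrix. -/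
def diagPoly : (LowPoly n)[X] :=
  -quarter n * (revPoly n (stB n) - revPoly n (stC n))

/-- The momentum coordinates on the stationary manifold. -/
def momentumPoly (i : Fin n) : LowPoly n :=
  -residue (posPoly n) (X ^ (n - 1 - (i : ℕ)) * diagPoly n)

variable {n}

theorem four_mul_C_quarter {σ : Type*} :
    (4 : MvPolynomial σ ℝ) * MvPolynomial.C (1 / 4) = 1 := by
  rw [← map_ofNat (MvPolynomial.C (σ := σ) (R := ℝ)) 4, ← MvPolynomial.C_mul]; norm_num

theorem four_mul_quarter : 4 * quarter n = 1 := by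
  rw [quarter, ← map_ofNat (C (R := LowPoly n)) 4, ← C_mul, four_mul_C_quarter, C_1]

theorem four_mul_posPoly (i : Fin n) : 4 * posPoly n i =
    -(2 * restr n (a (i + 1)) + restr n (b (i + 1)) + restr n (c (i + 1))) := by
  have h : restr n (MvPolynomial.C (1 / 4)) = MvPolynomial.C (1 / 4) := (restr n).commutes _
  rw [posPoly, map_mul, map_neg, h, map_add, map_add, map_mul, map_ofNat]
  linear_combination -(2 * restr n (a (i + 1)) + restr n (b (i + 1)) + restr n (c (i + 1))) *
    four_mul_C_quarter (σ := Fin 2 × Fin n)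

theorem coeff_zero_st : PowerSeries.coeff 0 (stA n) = -2 ∧ PowerSeries.coeff 0 (stB n) = 0 ∧
    PowerSeries.coeff 0 (stC n) = 0 := by
  simp only [stA, stB, stC, coeff_lowPart, if_pos (Nat.zero_le n), PowerSeries.coeff_map,
    coeff_zero_serA, coeff_zero_serB, coeff_zero_serC]
  exact ⟨by rw [map_neg, map_ofNat], map_zero _, map_zero _⟩

theorem coeff_succ_st {i : ℕ} (hi : i < n) :
    PowerSeries.coeff (i + 1) (stA n) = restr n (a (i + 1)) ∧
    PowerSeries.coeff (i + 1) (stB n) = restr n (b (i + 1)) ∧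
    PowerSeries.coeff (i + 1) (stC n) = restr n (c (i + 1)) := by
  simp only [stA, stB, stC, coeff_lowPart, if_pos (Nat.succ_le_of_lt hi), PowerSeries.coeff_map,
    coeff_succ_serA, coeff_succ_serB, coeff_succ_serC]
  simp

/-- The position coordinates are the Viète coordinates of `Q = -a/2 - b/4 - c/4`. -/
theorem four_mul_headPoly {k : ℕ} (hk : k ≤ n) : 4 * headPoly (posPoly n) k =
    -(2 * revPoly k (stA n) + revPoly k (stB n) + revPoly k (stC n)) := by
  obtain ⟨ha, hb, hc⟩ := coeff_zero_st (n := n)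
  ext1 m
  rw [← map_ofNat (C (R := LowPoly n)) 4, ← map_ofNat (C (R := LowPoly n)) 2, coeff_neg, coeff_add,
    coeff_add, coeff_C_mul, coeff_C_mul, coeff_revPoly, coeff_revPoly, coeff_revPoly]
  rcases lt_trichotomy m k with h | h | h
  · obtain ⟨ha, hb, hc⟩ := coeff_succ_st (show k - 1 - m < n by omega)
    rw [if_pos h.le, if_pos h.le, if_pos h.le, show k - m = k - 1 - m + 1 by omega, ha, hb, hc,
      coeff_headPoly_of_lt _ h hk, four_mul_posPoly]
  · rw [if_pos h.le, if_pos h.le, if_pos h.le, h, Nat.sub_self, ha, hb, hc,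
      coeff_headPoly_of_le _ le_rfl, if_pos rfl]
    norm_num
  · rw [if_neg (by omega), if_neg (by omega), if_neg (by omega), coeff_headPoly_of_le _ h.le,
      if_neg (by omega)]
    simp

theorem four_mul_vietePoly : 4 * vietePoly (posPoly n) =
    -(2 * revPoly n (stA n) + revPoly n (stB n) + revPoly n (stC n)) :=
  four_mul_headPoly le_rfl

theorem four_mul_diagPoly : 4 * diagPoly n = -(revPoly n (stB n) - revPoly n (stC n)) := by
  rw [diagPoly]
  linear_combination -(revPoly n (stB n) - revPoly n (stC n)) *
    four_mul_quarter (n := n)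

/-- The degree drops below `n` because `b_0 = c_0 = 0`. -/
theorem degree_diagPoly_lt : (diagPoly n).degree < n := by
  obtain ⟨-, hb, hc⟩ := coeff_zero_st (n := n)
  rw [degree_lt_iff_coeff_zero]
  intro m hm
  rw [diagPoly, quarter, ← C_neg, coeff_C_mul, coeff_sub, coeff_revPoly, coeff_revPoly]
  split_ifs
  · rw [show n - m = 0 by omega, hb, hc, sub_zero, mul_zero]
  · rw [sub_zero, mul_zero]

/-- The momenta are defined so that the entry `N` is their momentum polynomial `μ(λ)`. -/
theorem momPoly_momentumPoly : momPoly (posPoly n) (momentumPoly n) = diagPoly n :=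
  momPoly_residue _ degree_diagPoly_lt

/-- The determinant `a² - b c` of the stationary Lax matrix as a polynomial in `λ`. -/
def detPoly (n : ℕ) : (LowPoly n)[X] :=
  revPoly n (stA n) * revPoly n (stA n) - revPoly n (stB n) * revPoly n (stC n)

/-- The terms of degree at least `n` come from the orders `m ≤ n` of `a² - b c = 4`, on which the
truncation has no effect. -/
theorem coeff_detPoly_of_ge {m : ℕ} (hm : n ≤ m) :
    (detPoly n).coeff m = if m = 2 * n then 4 else 0 := by
  have h : detPoly n = revPoly (n + n) (stA n * stA n - stB n * stC n) := by
    have hl : ∀ f : PowerSeries (LowPoly n), lowPart n (lowPart n f) = lowPart n f := fun f => by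
      ext i; simp only [coeff_lowPart]; split_ifs <;> rfl
    rw [detPoly, ← revPoly_mul, ← revPoly_mul, ← revPoly_sub]
    simp only [stA, stB, stC, hl]
  rw [h, coeff_revPoly]
  split_ifs with h1 h2 h2
  · rw [coeff_det_stationary (by omega), if_pos (by omega)]
  · rw [coeff_det_stationary (by omega), if_neg (by omega)]
  · omega
  · rfl

/-- The remainder of `μ(λ)² - λ^{2n}` modulo `Q`. -/
def hamPoly (n : ℕ) : (LowPoly n)[X] := quarter n * detPoly n - X ^ (2 * n)

/-- The term `λ^{2n}` cancels the only term of `a² - b c` of degree at least `n`. -/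
theorem degree_hamPoly_lt : (hamPoly n).degree < n := by
  rw [degree_lt_iff_coeff_zero]
  intro m hm
  rw [hamPoly, quarter, coeff_sub, coeff_C_mul, coeff_detPoly_of_ge hm, coeff_X_pow]
  split_ifs
  · rw [mul_comm, four_mul_C_quarter, sub_self]
  · simp

/-- The remaining entry `T = -a/2 + b/4 + c/4` of the Lax matrix. -/
def cofactorPoly (n : ℕ) : (LowPoly n)[X] :=
  quarter n * (revPoly n (stB n) + revPoly n (stC n) - 2 * revPoly n (stA n))

/-- The determinant of `(N, Q; T, -N)` with `N = μ(λ)`. -/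
theorem diagPoly_sq : momPoly (posPoly n) (momentumPoly n) ^ 2 - X ^ (2 * n) =
    hamPoly n - vietePoly (posPoly n) * cofactorPoly n := by
  have h16 : (16 : (LowPoly n)[X]) ≠ 0 := by norm_num
  have h4 := four_mul_quarter (n := n)
  apply mul_left_cancel₀ h16
  rw [momPoly_momentumPoly, hamPoly, cofactorPoly, detPoly]
  set A := revPoly n (stA n)
  set B := revPoly n (stB n)
  set C' := revPoly n (stC n)
  linear_combination (4 * diagPoly n - (B - C')) * four_mul_diagPoly (n := n)
    + (B + C' - 2 * A) * four_mul_vietePoly (n := n)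
    + (-4 * (A * A - B * C') + 4 * vietePoly (posPoly n) * (B + C' - 2 * A)) * h4

/-- The restricted flow of `K_{k+1}` is the Lax equation of the polynomial Lax matrix with its
truncation. -/
theorem lax_polynomial {k : ℕ} (hk : k < n) :
    2 * polyD (restrD n (evolD (k + 1))) (revPoly n (stA n)) =
      revPoly n (stB n) * revPoly k (stC n) - revPoly k (stB n) * revPoly n (stC n) ∧
    polyD (restrD n (evolD (k + 1))) (revPoly n (stB n)) =
      revPoly k (stA n) * revPoly n (stB n) - revPoly n (stA n) * revPoly k (stB n) ∧
    polyD (restrD n (evolD (k + 1))) (revPoly n (stC n)) =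
      revPoly k (stC n) * revPoly n (stA n) - revPoly n (stC n) * revPoly k (stA n) := by
  have h := stationary_flow hk
  have hl : ∀ f : PowerSeries (LowPoly n), lowPart n (lowPart n f) = lowPart n f := fun f => by
    ext i; simp only [coeff_lowPart]; split_ifs <;> rfl
  have hA : lowPart n (stA n) = stA n := hl _
  have hB : lowPart n (stB n) = stB n := hl _
  have hC : lowPart n (stC n) = stC n := hl _
  have h1 : ∀ f g : PowerSeries (LowPoly n), lowPart n f = f →
      revPoly (n + k) (f * lowPart k g) = revPoly n f * revPoly k g := fun f g hf => by
    rw [← revPoly_mul, hf]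
  have h2 : ∀ f g : PowerSeries (LowPoly n), lowPart n f = f →
      revPoly (n + k) (lowPart k g * f) = revPoly k g * revPoly n f := fun f g hf => by
    rw [mul_comm, h1 f g hf, mul_comm]
  refine ⟨?_, ?_, ?_⟩
  · have := revPoly_congr fun m hm => (h m hm).1
    rwa [revPoly_two_mul, revPoly_X_pow_mul, ← polyD_revPoly, revPoly_sub, h1 _ _ hB,
      h2 _ _ hC] at this
  · have := revPoly_congr fun m hm => (h m hm).2.1
    rwa [revPoly_X_pow_mul, ← polyD_revPoly, revPoly_sub, h1 _ _ hA, h2 _ _ hB] at this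
  · have := revPoly_congr fun m hm => (h m hm).2.2
    rwa [revPoly_X_pow_mul, ← polyD_revPoly, revPoly_sub, h1 _ _ hC, h2 _ _ hA] at this

theorem polyD_four_mul {R : Type*} [CommRing R] [Algebra ℝ R] (δ : Derivation ℝ R R) (f : R[X]) :
    polyD δ (4 * f) = 4 * polyD δ f := by
  have h : ∀ f : R[X], 4 * f = f + f + f + f := fun f => by ring
  rw [h, h, map_add, map_add, map_add]

theorem polyD_two_mul {R : Type*} [CommRing R] [Algebra ℝ R] (δ : Derivation ℝ R R) (f : R[X]) :
    polyD δ (2 * f) = 2 * polyD δ f := by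
  rw [two_mul, map_add, two_mul]

/-- The restricted flow of `K_{k+1}` is Hamilton's system of `H_{k+1}` in the coordinates
`posPoly`, `momentumPoly`. -/
theorem hamilton_stationary (k i : Fin n) :
    restrD n (evolD (k + 1)) (posPoly n i) =
      stackelHamDP (posPoly n) (momentumPoly n) k i ∧
    restrD n (evolD (k + 1)) (momentumPoly n i) =
      -stackelHamDX (posPoly n) (momentumPoly n) k i := by
  obtain ⟨ha, hb, hc⟩ := lax_polynomial k.2
  have hQ := four_mul_vietePoly (n := n)
  have hk := four_mul_headPoly (n := n) k.2.le
  have hN := four_mul_diagPoly (n := n)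
  have h4 := four_mul_quarter (n := n)
  have dQ := congrArg (polyD (restrD n (evolD (k + 1)))) hQ
  have dN := congrArg (polyD (restrD n (evolD (k + 1)))) hN
  rw [polyD_four_mul, map_neg, map_add, map_add, polyD_two_mul, ha, hb, hc] at dQ
  rw [polyD_four_mul, map_neg, map_sub, hb, hc] at dN
  refine hamilton_of_lax (T := cofactorPoly n) (H := hamPoly n)
    (vN := -quarter n * (revPoly k (stB n) - revPoly k (stC n)))
    (vT := quarter n *
      (revPoly k (stB n) + revPoly k (stC n) - 2 * revPoly k (stA n)))
    degree_hamPoly_lt diagPoly_sq ?_ ?_ i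
  · have h8 : (8 : (LowPoly n)[X]) ≠ 0 := by norm_num
    apply mul_left_cancel₀ h8
    rw [momPoly_momentumPoly]
    set A := revPoly n (stA n)
    set B := revPoly n (stB n)
    set C' := revPoly n (stC n)
    set vA := revPoly k (stA n)
    set vB := revPoly k (stB n)
    set vC := revPoly k (stC n)
    linear_combination 2 * dQ + 4 * vietePoly (posPoly n) * (vB - vC) * h4 + (vB - vC) * hQ
      + 4 * headPoly (posPoly n) k * hN - (B - C') * hk
  · have h16 : (16 : (LowPoly n)[X]) ≠ 0 := by norm_num
    apply mul_left_cancel₀ h16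
    rw [momPoly_momentumPoly, cofactorPoly]
    set A := revPoly n (stA n)
    set B := revPoly n (stB n)
    set C' := revPoly n (stC n)
    set vA := revPoly k (stA n)
    set vB := revPoly k (stB n)
    set vC := revPoly k (stC n)
    linear_combination 4 * dN - 4 * headPoly (posPoly n) k * (B + C' - 2 * A) * h4
      - (B + C' - 2 * A) * hk
      + 4 * vietePoly (posPoly n) * (vB + vC - 2 * vA) * h4
      + (vB + vC - 2 * vA) * hQ

theorem stackelHam_stationary (k : Fin n) : stackelHam (posPoly n) (momentumPoly n) k =
    (hamPoly n).coeff (n - 1 - (k : ℕ)) := by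
  rw [coeff_eq_residue (posPoly n) degree_hamPoly_lt, stackelHam, diagPoly_sq, mul_sub, map_sub,
    mul_left_comm, residue_vietePoly_mul, sub_zero]

end VieteForm

/-! ### The coefficients of the determinant -/

section Determinant

open Polynomial

variable {n : ℕ}

theorem sum_Icc_one_eq_range {M : Type*} [AddCommMonoid M] (n : ℕ) (f : ℕ → M) :
    ∑ i ∈ Finset.Icc 1 n, f i = ∑ i ∈ Finset.range n, f (i + 1) := by
  have : Finset.Icc 1 n = Finset.Ico 1 (n + 1) := by ext; simp
  rw [this, Finset.sum_Ico_eq_sum_range]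
  exact Finset.sum_congr rfl fun i _ => by rw [add_comm]

theorem revPoly_serA (n : ℕ) : revPoly n serA =
    -2 * X ^ n + ∑ i ∈ Finset.Icc 2 n, C (a i) * X ^ (n + 1 - i - 1) := by
  have h : ∑ i ∈ Finset.Icc 2 n, C (a i) * X ^ (n + 1 - i - 1) =
      ∑ i ∈ Finset.Icc 1 n, C (a i) * X ^ (n + 1 - i - 1) := by
    refine Finset.sum_subset (Finset.Icc_subset_Icc_left one_le_two) fun i hi hi' => ?_
    rw [Finset.mem_Icc] at hi hi'
    obtain rfl : i = 1 := by omega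
    rw [a_one, C_0, zero_mul]
  rw [h, sum_Icc_one_eq_range, revPoly, Finset.sum_range_succ', coeff_zero_serA, add_comm,
    C_neg, map_ofNat, Nat.sub_zero]
  refine congrArg (-2 * X ^ n + ·) (Finset.sum_congr rfl fun i _ => ?_)
  rw [coeff_succ_serA, show n - (i + 1) = n + 1 - (i + 1) - 1 by omega]

theorem revPoly_serB (n : ℕ) : revPoly n serB =
    ∑ i ∈ Finset.Icc 1 n, C (b i) * X ^ (n + 1 - i - 1) := by
  rw [sum_Icc_one_eq_range, revPoly, Finset.sum_range_succ', coeff_zero_serB, C_0, zero_mul,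
    add_zero]
  refine Finset.sum_congr rfl fun i _ => ?_
  rw [coeff_succ_serB, show n - (i + 1) = n + 1 - (i + 1) - 1 by omega]

theorem revPoly_serC (n : ℕ) : revPoly n serC =
    ∑ i ∈ Finset.Icc 1 n, C (c i) * X ^ (n + 1 - i - 1) := by
  rw [sum_Icc_one_eq_range, revPoly, Finset.sum_range_succ', coeff_zero_serC, C_0, zero_mul,
    add_zero]
  refine Finset.sum_congr rfl fun i _ => ?_
  rw [coeff_succ_serC, show n - (i + 1) = n + 1 - (i + 1) - 1 by omega]

theorem four_mul_det_of_two_mul_eq_one {R : Type*} [CommRing R] {c : R} (hc : 2 * c = 1)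
    (P S B C : R) : 4 * ((-P + c * S) * -(-P + c * S) - -c * B * (c * C)) =
      -((-2 * P + S) * (-2 * P + S) - B * C) := by
  linear_combination (4 * P * S + (2 * c + 1) * (B * C - S * S)) * hc

/-- Minus four times `det 𝕌_{n+1}` is the truncated determinant `a² - b c`. -/
theorem four_mul_det_U (n : ℕ) : 4 * (U (n + 1)).det =
    -(revPoly n serA * revPoly n serA - revPoly n serB * revPoly n serC) := by
  have h2 : (2 : DiffPoly[X]) * C (MvPolynomial.C (1 / 2)) = 1 := by
    rw [← map_ofNat (C (R := DiffPoly)) 2, ← C_mul, two_mul_C_half, C_1]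
  rw [revPoly_serA, revPoly_serB, revPoly_serC, ← four_mul_det_of_two_mul_eq_one h2]
  unfold U
  simp only [Matrix.det_fin_two_of, Nat.add_sub_cancel]

theorem four_mul_restr_h (n j : ℕ) : 4 * restr n (h n j) = -(detPoly n).coeff j := by
  have hd := congrArg (fun f => (f.map (restr n : DiffPoly →+* LowPoly n)).coeff j)
    (four_mul_det_U n)
  simp only [Polynomial.map_mul, Polynomial.map_neg, Polynomial.map_sub, map_revPoly,
    Polynomial.map_ofNat] at hd
  rw [← map_ofNat (C (R := LowPoly n)) 4, coeff_C_mul, coeff_neg, coeff_map] at hd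
  rw [detPoly, stA, stB, stC, revPoly_lowPart, revPoly_lowPart, revPoly_lowPart]
  exact hd

theorem stackelHam_eq_h (k : Fin n) : stackelHam (posPoly n) (momentumPoly n) k =
    -restr n (h n (n - ((k : ℕ) + 1))) := by
  have hk := k.2
  rw [stackelHam_stationary, hamPoly, quarter, coeff_sub, coeff_C_mul, coeff_X_pow,
    if_neg (by omega), sub_zero, show n - 1 - (k : ℕ) = n - (k + 1) by omega]
  linear_combination MvPolynomial.C (1 / 4) * four_mul_restr_h n (n - (k + 1)) -
    restr n (h n (n - (k + 1))) * four_mul_C_quarter (σ := Fin 2 × Fin n)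

end Determinant

/-! ### The change of variables as an algebra isomorphism -/

section Isomorphism

open MvPolynomial

variable (n : ℕ)

/-- Polynomials in the Viète coordinates and momenta. -/
abbrev PhasePoly : Type := MvPolynomial (Fin n ⊕ Fin n) ℝ

/-- Substitution of the position and momentum coordinates on the stationary manifold. -/
def pullback : PhasePoly n →ₐ[ℝ] LowPoly n := aeval (Sum.elim (posPoly n) (momentumPoly n))

variable {n}

theorem pullback_inl (i : Fin n) : pullback n (X (Sum.inl i)) = posPoly n i := by
  simp [pullback]

theorem pullback_inr (i : Fin n) : pullback n (X (Sum.inr i)) = momentumPoly n i := by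
  simp [pullback]

theorem coeff_diagPoly_mem (m : ℕ) : (diagPoly n).coeff m ∈ (pullback n).range := by
  have e : diagPoly n = (momPoly (fun i => X (Sum.inl i)) fun i => X (Sum.inr i)).map
      (pullback n : PhasePoly n →+* LowPoly n) := by
    rw [map_momPoly, ← momPoly_momentumPoly]
    congr 1
    · ext1 i; exact (pullback_inl i).symm
    · ext1 i; exact (pullback_inr i).symm
  rw [e, Polynomial.coeff_map]
  exact ⟨_, rfl⟩

/-- The differences `b_i - c_i` are the coefficients of `-4 μ(λ)`. -/
theorem b_sub_c_mem {i : ℕ} (hi : i < n) :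
    restr n (b (i + 1)) - restr n (c (i + 1)) ∈ (pullback n).range := by
  obtain ⟨-, hb, hc⟩ := coeff_succ_st hi
  have h := congrArg (fun f => f.coeff (n - 1 - i)) (four_mul_diagPoly (n := n))
  rw [← map_ofNat (Polynomial.C (R := LowPoly n)) 4, Polynomial.coeff_C_mul, Polynomial.coeff_neg,
    Polynomial.coeff_sub, coeff_revPoly, coeff_revPoly, if_pos (by omega), if_pos (by omega),
    show n - (n - 1 - i) = i + 1 by omega, hb, hc] at h
  rw [← neg_neg (_ - _), ← h]
  exact neg_mem (mul_mem (ofNat_mem _ 4) (coeff_diagPoly_mem _))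

/-- On the stationary manifold, `a_i, b_i, c_i` for `i ≤ n` are polynomials in positions and
momenta, because `a_i` is a polynomial in the preceding `a_j, b_j, c_j`. -/
theorem abc_mem (i : ℕ) (hi : i < n) : restr n (a (i + 1)) ∈ (pullback n).range ∧
    restr n (b (i + 1)) ∈ (pullback n).range ∧ restr n (c (i + 1)) ∈ (pullback n).range := by
  induction i using Nat.strong_induction_on with
  | _ i ih =>
    have hC : ∀ t : ℝ, (C t : LowPoly n) ∈ (pullback n).range := fun t =>
      (pullback n).range.algebraMap_mem t
    have ha : restr n (a (i + 1)) ∈ (pullback n).range := by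
      rcases i with _ | i
      · rw [a_one, map_zero]; exact zero_mem _
      · have h := congrArg (restr n) (four_mul_a i)
        rw [map_mul, map_ofNat, map_sum] at h
        have h4 : restr n (a (i + 2)) = C (1 / 4) * (4 * restr n (a (i + 2))) := by
          linear_combination -restr n (a (i + 2)) * four_mul_C_quarter (σ := Fin 2 × Fin n)
        rw [h4, h]
        refine mul_mem (hC _) (sum_mem fun p hp => ?_)
        have := Finset.HasAntidiagonal.mem_antidiagonal.1 hp
        rw [map_sub, map_mul, map_mul]
        obtain ⟨h1, h2, -⟩ := ih p.1 (by omega) (by omega)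
        obtain ⟨h3, -, h4⟩ := ih p.2 (by omega) (by omega)
        exact sub_mem (mul_mem h1 h3) (mul_mem h2 h4)
    have hsub := b_sub_c_mem hi
    have hpos := four_mul_posPoly ⟨i, hi⟩
    have hp : posPoly n ⟨i, hi⟩ ∈ (pullback n).range := ⟨_, pullback_inl _⟩
    have h2 : (2 : LowPoly n) * C (1 / 2) = 1 := by
      rw [← map_ofNat (C (σ := Fin 2 × Fin n) (R := ℝ)) 2, ← C_mul]; norm_num
    have hsum : restr n (b (i + 1)) + restr n (c (i + 1)) ∈ (pullback n).range := by
      have : restr n (b (i + 1)) + restr n (c (i + 1)) =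
          -(4 * posPoly n ⟨i, hi⟩ + 2 * restr n (a (i + 1))) := by
        linear_combination hpos
      rw [this]
      exact neg_mem (add_mem (mul_mem (ofNat_mem _ 4) hp) (mul_mem (ofNat_mem _ 2) ha))
    refine ⟨ha, ?_, ?_⟩
    · convert mul_mem (hC (1 / 2)) (add_mem hsum hsub) using 1
      linear_combination -restr n (b (i + 1)) * h2
    · convert mul_mem (hC (1 / 2)) (sub_mem hsum hsub) using 1
      linear_combination -restr n (c (i + 1)) * h2

/-- The jet coordinate of order `m` is recovered from the leading term of `b_{m+1}` or `c_{m+1}`. -/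
theorem X_mem_range (m : ℕ) (i : Fin 2) (hm : m < n) :
    restr n (X (i, m)) ∈ (pullback n).range := by
  induction m using Nat.strong_induction_on generalizing i with
  | _ m ih =>
    have hlow : ∀ f ∈ orderLT m, restr n f ∈ (pullback n).range := by
      have : orderLT m ≤ (pullback n).range.comap (restr n) := by
        refine Algebra.adjoin_le ?_
        rintro _ ⟨⟨j, l⟩, hl, rfl⟩
        exact ih l hl j (lt_trans hl hm)
      exact fun f hf => this hf
    have hC : ∀ t : ℝ, (C t : LowPoly n) ∈ (pullback n).range := fun t =>
      (pullback n).range.algebraMap_mem t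
    have hev : restr n (evolField (m + 1) (i, 0)) ∈ (pullback n).range := by
      obtain ⟨-, hb, hc⟩ := abc_mem m hm
      unfold evolField
      dsimp only [Function.iterate_zero, id]
      split_ifs
      exacts [hb, hc]
    have hl : restr n (lowerTerm m (i, 0)) ∈ (pullback n).range := hlow _ (lowerTerm_mem m (i, 0))
    have hc : restr n (C (lead m i)) = C (lead m i) := (restr n).commutes _
    rw [evolField_eq, map_add, map_mul, hc] at hev
    have h1 : C (lead m i) * restr n (X (i, m)) ∈ (pullback n).range := by
      simpa using sub_mem hev hl
    convert mul_mem (hC (lead m i)⁻¹) h1 using 1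
    rw [← mul_assoc, ← C_mul, inv_mul_cancel₀ (lead_ne_zero m i), C_1, one_mul]

theorem pullback_surjective : Function.Surjective (pullback n) := by
  rw [← AlgHom.range_eq_top, eq_top_iff, ← adjoin_range_X]
  refine Algebra.adjoin_le ?_
  rintro _ ⟨⟨i, m⟩, rfl⟩
  have := X_mem_range (n := n) m i m.2
  rwa [restr_X_low (i, m)] at this

/-- A surjective endomorphism of a Noetherian ring is injective. -/
theorem injective_of_surjective_endomorphism {R : Type*} [CommRing R] [IsNoetherianRing R]
    (f : R →+* R) (hf : Function.Surjective f) : Function.Injective f := by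
  obtain ⟨N, hN⟩ := monotone_stabilizes_iff_noetherian.2 (inferInstanceAs (IsNoetherian R R))
    ⟨fun m => RingHom.ker (f ^ m), monotone_nat_of_le_succ fun m x hx => by
      rw [RingHom.mem_ker] at hx ⊢
      rw [pow_succ', RingHom.mul_def, RingHom.comp_apply, hx, map_zero]⟩
  rw [injective_iff_map_eq_zero]
  intro x hx
  have hs : Function.Surjective (f ^ N) := by
    rw [RingHom.coe_pow]; exact hf.iterate N
  obtain ⟨y, rfl⟩ := hs x
  have h1 : y ∈ RingHom.ker (f ^ (N + 1)) := by
    rw [RingHom.mem_ker, pow_succ', RingHom.mul_def, RingHom.comp_apply, hx]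
  have h2 : RingHom.ker (f ^ N) = RingHom.ker (f ^ (N + 1)) := hN (N + 1) N.le_succ
  rw [← h2] at h1
  exact h1

/-- The two polynomial rings have the same number of variables, so a surjection between them is
an isomorphism. -/
theorem pullback_bijective : Function.Bijective (pullback n) := by
  refine ⟨?_, pullback_surjective⟩
  have hcard : Fintype.card (Fin 2 × Fin n) = Fintype.card (Fin n ⊕ Fin n) := by
    simp [two_mul]
  -- an identification of the variables turns `pullback` into a surjective endomorphism
  let e := renameEquiv ℝ (Fintype.equivOfCardEq hcard)
  have h := injective_of_surjective_endomorphism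
    ((e : LowPoly n →+* PhasePoly n).comp (pullback n : PhasePoly n →+* LowPoly n))
    (e.surjective.comp pullback_surjective)
  intro x y hxy
  exact h (congrArg e hxy)

variable (n)

/-- The isomorphism between polynomials in the Viète coordinates and polynomials in the jet
coordinates of order less than `n`. -/
def pullbackEquiv : PhasePoly n ≃ₐ[ℝ] LowPoly n :=
  AlgEquiv.ofBijective (pullback n) pullback_bijective

/-- The inverse of the map to Viète coordinates. -/
def fromViete (w : Phase n) : LowJet n :=
  fun s => eval (Sum.elim w.1 w.2) ((pullbackEquiv n).symm (X s))

variable {n}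

/-- `pullback` is composition with the map from jets to Viète coordinates. -/
theorem eval_pullback (y : LowJet n) (f : PhasePoly n) : eval y (pullback n f) =
    eval (Sum.elim (fun i => eval y (posPoly n i)) fun i => eval y (momentumPoly n i)) f := by
  have : ((aeval y).comp (pullback n) : PhasePoly n →ₐ[ℝ] ℝ) =
      aeval (Sum.elim (fun i => eval y (posPoly n i)) fun i => eval y (momentumPoly n i)) := by
    refine MvPolynomial.algHom_ext fun s => ?_
    rcases s with i | i <;> simp [pullback, aeval_eq_eval]
  simpa [aeval_eq_eval] using congrArg (fun φ => φ f) this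

end Isomorphism

/-! ### The map to Viète coordinates -/

section Transformation

open MvPolynomial Matrix

variable {n : ℕ}

theorem positions_jetMap (y : LowJet n) :
    positions n (jetMap n y) = fun i => eval y (posPoly n i) := by
  ext i
  have h := congrArg (eval y) (four_mul_posPoly i)
  simp only [map_mul, map_neg, map_add, map_ofNat] at h
  rw [positions, eval_jetMap, eval_jetMap, eval_jetMap]
  linarith

/-- The momenta of the definition through `G⁻¹` agree with those defined by residues, since `G` acts
on momenta as multiplication by `-2 μ(λ)`. -/
theorem momenta_jetMap (y : LowJet n) :
    momenta n (jetMap n y) = fun i => eval y (momentumPoly n i) := by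
  set x : Fin n → ℝ := fun i => eval y (posPoly n i) with hx
  set p : Fin n → ℝ := fun i => eval y (momentumPoly n i) with hp
  have hN : momPoly x p = (diagPoly n).map (eval y) := by
    rw [← momPoly_momentumPoly, map_momPoly]
  have hG : G x *ᵥ p = fun j : Fin n => 1 / 2 * (eval (jetMap n y) (b (j + 1)) -
      eval (jetMap n y) (c (j + 1))) := by
    ext j
    have h1 := congrArg (fun f => f.coeff (n - 1 - (j : ℕ))) (vecPoly_G_mulVec x p)
    have hj := j.2
    obtain ⟨-, hb, hc⟩ := coeff_succ_st hj
    have h2 := congrArg (fun f => (f.map (eval y)).coeff (n - 1 - (j : ℕ)))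
      (four_mul_diagPoly (n := n))
    simp only [Polynomial.map_mul, Polynomial.map_neg, Polynomial.map_sub,
      Polynomial.map_ofNat, ← hN, Polynomial.coeff_neg, Polynomial.coeff_sub,
      Polynomial.coeff_map, coeff_revPoly] at h1 h2
    rw [if_pos (by omega), if_pos (by omega), show n - (n - 1 - (j : ℕ)) = j + 1 by omega, hb, hc,
      ← map_ofNat (Polynomial.C (R := ℝ)) 4, Polynomial.coeff_C_mul] at h2
    rw [coeff_vecPoly, dif_pos (by omega), ← map_ofNat (Polynomial.C (R := ℝ)) 2,
      Polynomial.coeff_C_mul] at h1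
    have e : (⟨n - 1 - (n - 1 - (j : ℕ)), by omega⟩ : Fin n) = j := Fin.ext (by dsimp; omega)
    rw [e] at h1
    rw [eval_jetMap, eval_jetMap]
    linarith
  have hu : momenta n (jetMap n y) = (G x)⁻¹ *ᵥ (G x *ᵥ p) := by
    rw [hG]
    ext i
    rw [momenta, positions_jetMap, ← hx, Finset.mul_sum]
    refine Finset.sum_congr rfl fun j _ => ?_
    ring
  rw [hu, Matrix.mulVec_mulVec, Matrix.nonsing_inv_mul _ (isUnit_det_G x), Matrix.one_mulVec]

theorem toViete_jetMap (y : LowJet n) : toViete n (jetMap n y) =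
    (fun i => eval y (posPoly n i), fun i => eval y (momentumPoly n i)) := by
  rw [toViete, positions_jetMap, momenta_jetMap]

theorem eval_toViete (y : LowJet n) (f : PhasePoly n) :
    eval (Sum.elim (toViete n (jetMap n y)).1 (toViete n (jetMap n y)).2) f =
      eval y (pullback n f) := by
  rw [toViete_jetMap, eval_pullback]

theorem contDiff_toViete_jetMap {m : WithTop ℕ∞} :
    ContDiff ℝ m fun y => toViete n (jetMap n y) := by
  simp only [toViete_jetMap]
  exact (contDiff_pi.2 fun i => contDiff_eval _).prodMk (contDiff_pi.2 fun i => contDiff_eval _)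

theorem contDiff_fromViete {m : WithTop ℕ∞} : ContDiff ℝ m (fromViete n) := by
  refine contDiff_pi.2 fun s => ?_
  refine (contDiff_eval ((pullbackEquiv n).symm (X s))).comp (contDiff_pi.2 fun t => ?_)
  rcases t with i | i
  · exact (contDiff_apply ℝ ℝ i).comp contDiff_fst
  · exact (contDiff_apply ℝ ℝ i).comp contDiff_snd

theorem fromViete_toViete (y : LowJet n) : fromViete n (toViete n (jetMap n y)) = y := by
  ext s
  rw [fromViete, eval_toViete]
  have : pullback n ((pullbackEquiv n).symm (X s)) = X s := (pullbackEquiv n).apply_symm_apply _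
  rw [this, eval_X]

theorem toViete_fromViete (w : Phase n) : toViete n (jetMap n (fromViete n w)) = w := by
  have h : ∀ f : PhasePoly n, eval (fromViete n w) (pullback n f) = eval (Sum.elim w.1 w.2) f := by
    intro f
    have : ((aeval (fromViete n w)).comp ((pullbackEquiv n : PhasePoly n →ₐ[ℝ] LowPoly n)) :
        PhasePoly n →ₐ[ℝ] ℝ) = aeval (Sum.elim w.1 w.2) := by
      have h0 : (aeval (fromViete n w) : LowPoly n →ₐ[ℝ] ℝ) = (aeval (Sum.elim w.1 w.2)).comp
          ((pullbackEquiv n).symm : LowPoly n →ₐ[ℝ] PhasePoly n) :=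
        MvPolynomial.algHom_ext fun s => by simp [fromViete, aeval_eq_eval]
      rw [h0]
      ext f
      simp
    simpa [aeval_eq_eval, pullbackEquiv] using congrArg (fun φ => φ f) this
  rw [toViete_jetMap]
  refine Prod.ext ?_ ?_
  · ext i
    have := h (X (Sum.inl i))
    rwa [pullback_inl, eval_X] at this
  · ext i
    have := h (X (Sum.inr i))
    rwa [pullback_inr, eval_X] at this

theorem hamiltonian_eq_eval (k : Fin n) (w : Phase n) : hamiltonian k w =
    eval (Sum.elim w.1 w.2)
      (stackelHam (fun i => X (Sum.inl i) : Fin n → PhasePoly n) (fun i => X (Sum.inr i)) k) := by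
  rw [map_stackelHam, hamiltonian_eq]
  simp

theorem hamiltonian_toViete (k : Fin n) (y : LowJet n) :
    hamiltonian k (toViete n (jetMap n y)) =
      eval y (stackelHam (posPoly n) (momentumPoly n) k) := by
  rw [hamiltonian_eq, toViete_jetMap, map_stackelHam]

/-- `fderiv_eval` for polynomial functions of a pair of a position and a momentum. -/
theorem fderiv_eval_phase (δ : Derivation ℝ (PhasePoly n) (PhasePoly n)) (w u : Phase n)
    (hδ : ∀ s, eval (Sum.elim w.1 w.2) (δ (X s)) = Sum.elim u.1 u.2 s) (f : PhasePoly n) :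
    fderiv ℝ (fun w : Phase n => eval (Sum.elim w.1 w.2) f) w u =
      eval (Sum.elim w.1 w.2) (δ f) := by
  let L : Phase n →L[ℝ] (Fin n ⊕ Fin n → ℝ) := ContinuousLinearMap.pi fun s =>
    Sum.elim (fun i => (ContinuousLinearMap.proj (R := ℝ) (φ := fun _ : Fin n => ℝ) i).comp
      (ContinuousLinearMap.fst ℝ (Fin n → ℝ) (Fin n → ℝ)))
      (fun i => (ContinuousLinearMap.proj (R := ℝ) (φ := fun _ : Fin n => ℝ) i).comp
        (ContinuousLinearMap.snd ℝ (Fin n → ℝ) (Fin n → ℝ))) s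
  have hL : ∀ w : Phase n, L w = Sum.elim w.1 w.2 := by
    intro w
    ext s
    rcases s with i | i <;> rfl
  have h1 := ((differentiableAt_eval f (L w)).hasFDerivAt.comp w L.hasFDerivAt).fderiv
  have h2 : (fun w : Phase n => eval (Sum.elim w.1 w.2) f) =
      (fun y : Fin n ⊕ Fin n → ℝ => eval y f) ∘ L := by
    ext w
    rw [Function.comp_apply, hL]
  have h3 : L u = fun s => eval (L w) (δ (X s)) := by
    rw [hL, hL]
    ext s
    exact (hδ s).symm
  rw [h2, h1, ContinuousLinearMap.comp_apply, h3, fderiv_eval, hL]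

/-- Hamilton's equations of `H_k` in terms of the residue formulas for its derivatives. -/
theorem hamField_hamiltonian (k : Fin n) (w : Phase n) :
    hamField (hamiltonian k) w =
      (fun i => stackelHamDP w.1 w.2 k i, fun i => -stackelHamDX w.1 w.2 k i) := by
  have hH : (hamiltonian k : Phase n → ℝ) = fun w => eval (Sum.elim w.1 w.2)
      (stackelHam (fun i => X (Sum.inl i) : Fin n → PhasePoly n) (fun i => X (Sum.inr i)) k) :=
    funext (hamiltonian_eq_eval k)
  rw [hamField, hH]
  refine Prod.ext ?_ ?_
  · ext i
    dsimp only
    rw [fderiv_eval_phase (pderiv (Sum.inr i)) w (0, Pi.single i 1),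
      derivation_stackelHam_momentum (i := i), map_stackelHamDP]
    · simp
    · intro j; simp
    · intro j
      simp [pderiv_X, Pi.single_apply, eq_comm]
    · intro s
      rcases s with j | j
      · simp
      · by_cases hj : j = i
        · subst hj; simp
        · simp [pderiv_X, hj]
  · ext i
    dsimp only
    rw [fderiv_eval_phase (pderiv (Sum.inl i)) w (Pi.single i 1, 0),
      derivation_stackelHam_position (i := i), map_stackelHamDX]
    · simp
    · intro j
      simp [pderiv_X, Pi.single_apply, eq_comm]
    · intro j; simp
    · intro s
      rcases s with j | j
      · by_cases hj : j = i
        · subst hj; simp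
        · simp [pderiv_X, hj]
      · simp

theorem fderiv_toViete (k : Fin n) (y : LowJet n) :
    fderiv ℝ (fun y' => toViete n (jetMap n y')) y (restrictedField n (k + 1) (jetMap n y)) =
      hamField (hamiltonian k) (toViete n (jetMap n y)) := by
  have hd : ∀ f : LowPoly n, DifferentiableAt ℝ (fun y : LowJet n => eval y f) y := fun f =>
    differentiableAt_eval f y
  have h1 := (hasFDerivAt_pi.2 fun i => (hd (posPoly n i)).hasFDerivAt).prodMk
    (hasFDerivAt_pi.2 fun i => (hd (momentumPoly n i)).hasFDerivAt)
  have h2 : (fun y' => toViete n (jetMap n y')) = fun y' : LowJet n =>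
      ((fun i => eval y' (posPoly n i), fun i => eval y' (momentumPoly n i)) : Phase n) :=
    funext toViete_jetMap
  rw [hamField_hamiltonian, h2, h1.fderiv, toViete_jetMap]
  refine Prod.ext ?_ ?_
  · ext i
    dsimp only
    rw [← map_stackelHamDP, ← (hamilton_stationary k i).1, ← fderiv_restrictedField]
    rfl
  · ext i
    dsimp only
    rw [← map_stackelHamDX, ← map_neg, ← (hamilton_stationary k i).2, ← fderiv_restrictedField]
    rfl

end Transformation

end AKNS

end

theorem theorem1 (n : ℕ) :
    -- the hierarchy is local: every integrand `r b_k + q c_k` is a total derivative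
    (∀ k : ℕ, 1 ≤ k → AKNS.D (AKNS.a k) = AKNS.r * AKNS.b k + AKNS.q * AKNS.c k) ∧
    -- the metric is invertible, so that the momenta are well defined
    (∀ x : Fin n → ℝ, IsUnit (AKNS.G x).det) ∧
    -- the Hamiltonians solve the separation relations, and the Viète transformation is canonical
    (∀ ξ : AKNS.Phase n, Function.Injective ξ.1 →
      (∀ i : Fin n, ξ.1 i ^ (2 * n) +
          ∑ k : Fin n, AKNS.hamiltonian k (AKNS.viete ξ) * ξ.1 i ^ (n - ((k : ℕ) + 1))
            = ξ.2 i ^ 2) ∧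
      DifferentiableAt ℝ AKNS.viete ξ ∧
      ∀ η : AKNS.Phase n,
        ∑ i : Fin n, (AKNS.viete ξ).2 i * (fderiv ℝ AKNS.viete ξ η).1 i
          = ∑ i : Fin n, ξ.2 i * η.1 i) ∧
    -- the low order jet coordinates are global coordinates on the stationary manifold;
    -- `ψ` is the parametrization by them
    ∃ ψ : AKNS.LowJet n → AKNS.Jet,
      (∀ s, ContDiff ℝ ∞ fun y => ψ y s) ∧
      (∀ y, ψ y ∈ AKNS.stationary n ∧ AKNS.jetCoords n (ψ y) = y) ∧
      (∀ z ∈ AKNS.stationary n, ψ (AKNS.jetCoords n z) = z) ∧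
      -- the flows `K_1, …, K_n` are tangent to the stationary manifold
      (∀ k : Fin n, ∀ y, ∀ s,
        fderiv ℝ (fun y' => ψ y' s) y (AKNS.restrictedField n (k + 1) (ψ y))
          = MvPolynomial.eval (ψ y) (AKNS.evolField (k + 1) s)) ∧
      -- the map to Viète coordinates is a diffeomorphism
      ContDiff ℝ ∞ (fun y => AKNS.toViete n (ψ y)) ∧
      (∃ Θ : AKNS.Phase n → AKNS.LowJet n, ContDiff ℝ ∞ Θ ∧
        (∀ y, Θ (AKNS.toViete n (ψ y)) = y) ∧ ∀ w, AKNS.toViete n (ψ (Θ w)) = w) ∧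
      -- it carries the flow `K_k` to the Hamiltonian flow of `H_k`
      (∀ k : Fin n, ∀ y,
        fderiv ℝ (fun y' => AKNS.toViete n (ψ y')) y (AKNS.restrictedField n (k + 1) (ψ y))
          = AKNS.hamField (AKNS.hamiltonian k) (AKNS.toViete n (ψ y))) ∧
      -- and `H_k = -h_{n-k}`
      (∀ k : Fin n, ∀ y,
        AKNS.hamiltonian k (AKNS.toViete n (ψ y))
          = -MvPolynomial.eval (ψ y) (AKNS.h n (n - ((k : ℕ) + 1)))) := by
  refine ⟨fun k hk => AKNS.D_a hk, AKNS.isUnit_det_G, fun ξ hξ => ⟨AKNS.separation_relation hξ,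
    AKNS.differentiableAt_viete hξ, AKNS.canonical_viete hξ⟩, AKNS.jetMap n,
    fun s => AKNS.contDiff_eval _, fun y => ⟨AKNS.jetMap_mem n y, AKNS.jetCoords_jetMap n y⟩,
    fun z hz => AKNS.jetMap_jetCoords hz, fun k y s => ?_, AKNS.contDiff_toViete_jetMap,
    ⟨AKNS.fromViete n, AKNS.contDiff_fromViete, AKNS.fromViete_toViete, AKNS.toViete_fromViete⟩,
    AKNS.fderiv_toViete, fun k y => ?_⟩
  · have h := AKNS.fderiv_restrictedField n (k + 1) y (AKNS.restr n (MvPolynomial.X s))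
    rw [← AKNS.restr_evolD, AKNS.evolD, MvPolynomial.mkDerivation_X, AKNS.restr,
      MvPolynomial.aeval_X, ← AKNS.restr, ← AKNS.eval_jetMap] at h
    exact h
  · rw [AKNS.hamiltonian_toViete, AKNS.stackelHam_eq_h, map_neg, AKNS.eval_jetMap]
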